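/- Let $G$ be a finite group with unit $e$ and $H$ a normal subgroup of $G$. Let $\mathcal F_{H,loc}$ be the unital complex $*$-algebra generated by $\delta_g(x)$, $\rho_h(l)$ ($g\in G$, $h\in H$, $x\in\mathbb Z$, $l\in\mathbb Z+\frac12$) subject to $\sum_{g\in G}\delta_g(x)=I=\rho_e(l)$, $\delta_{g_1}(x)\delta_{g_2}(x)=\delta_{g_1,g_2}\delta_{g_1}(x)$, $\rho_{h_1}(l)\rho_{h_2}(l)=\rho_{h_1h_2}(l)$, $\delta_{g_1}(x)\delta_{g_2}(x')=\delta_{g_2}(x')\delta_{g_1}(x)$, $\rho_h(l)\delta_g(x)=\delta_{hg}(x)\rho_h(l)$ if $l<x$, $\rho_h(l)\delta_g(x)=\delta_g(x)\rho_h(l)$ if $l>x$, and $\rho_{h_1}(l)\rho_{h_2}(l')=\rho_{h_2}(l')\rho_{h_2^{-1}h_1h_2}(l)$ if $l>l'$, with $\delta_g(x)^*=\delta_g(x)$ and $\rho_h(l)^*=\rho_{h^{-1}}(l)$. It is an increasing union of finite-dimensional $C^*$-algebras; let the field algebra $\mathcal F_H$ be its completion in the (unique) $C^*$-norm, i.e.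 the $C^*$-inductive limit. Let $D(H;G)$ be the crossed product of $C(H)$ and $\mathbb CG$ with respect to the adjoint action, with linear basis $(h,g)$, $h\in H$, $g\in G$. It acts on $\mathcal F_H$ by the continuous action determined by $(h,g)I=\delta_{h,e}I$, $(h,g)\delta_f(x)=\delta_{h,e}\,\delta_{gf}(x)$, $(h,g)\rho_t(l)=\delta_{h,gtg^{-1}}\,\rho_h(l)$ and $(h,g)(F_1F_2)=\sum_{t\in H}(t,g)(F_1)\,(t^{-1}h,g)(F_2)$. Put $z_H=\frac1{|G|}\sum_{g\in G}(e,g)$ and $\mathcal A_{(H,G)}=\{F\in\mathcal F_H: z_H(F)=F\}$. A finite family $\{(u_i,u_i^*)\}$ is a quasi-basis for a conditional expectation $\Gamma$ of a unital $C^*$-algebra $B$ onto a unital $C^*$-subalgebra if $\sum_i u_i\Gamma(u_i^*a)=a=\sum_i\Gamma(au_i)u_i^*$ for all $a\in B$. If a quasi-basis exists, $\Gamma$ is of index-finite type and its $C^*$-index is $\sum_i u_iu_i^*$. Theorem. The map $z_H:\mathcal F_H\to\mathcal A_{(H,G)}$ is a conditional expectation of index-finite type. For every $k\in\mathbb Z$,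 the elements $u_{x,y}=\sqrt{|G|}\,\delta_x(k)\rho_y(k+\tfrac12)$ ($x\in G$, $y\in H$) give a quasi-basis $\{(u_{x,y},u_{x,y}^*)\}$ of $z_H$, and $\sum_{x\in G,\,y\in H}u_{x,y}u_{x,y}^*=|G||H|\,I$. Every quasi-basis $\{(u_i,u_i^*)\}$ of $z_H$ gives the same value, so that $$\mathrm{Index}\,z_H=|G||H|\,I.$$ In particular, for $H=G$, $\mathrm{Index}\,z_G=|G|^2 I$. -/

import Mathlib

set_option linter.unusedSectionVars false

noncomputable section

namespace GSpin

section LocalAlgebra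

variable {G : Type*} [Group G] [Fintype G] (H : Subgroup G)

/-- The generators of the local field algebra: `delta g x` stands for `δ_g(x)` with `x ∈ ℤ`, and
`rho h j` stands for `ρ_h(l)` at the half-integer site `l = j + 1/2`, with `j ∈ ℤ`.
In particular `l < x` means `j < x` and `l > x` means `x ≤ j`. -/
inductive Gen : Type _
  | delta (g : G) (x : ℤ) : Gen
  | rho (h : H) (j : ℤ) : Gen

/-- `δ_g(x)` in the free algebra. -/
abbrev fδ (g : G) (x : ℤ) : FreeAlgebra ℂ (Gen H) := FreeAlgebra.ι ℂ (Gen.delta g x)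

/-- `ρ_h(j + 1/2)` in the free algebra. -/
abbrev fρ (h : H) (j : ℤ) : FreeAlgebra ℂ (Gen H) := FreeAlgebra.ι ℂ (Gen.rho h j)

/-- The defining relations of the local field algebra. -/
inductive Rel : FreeAlgebra ℂ (Gen H) → FreeAlgebra ℂ (Gen H) → Prop
  | delta_sum (x : ℤ) : Rel (∑ g : G, fδ H g x) 1
  | rho_one (j : ℤ) : Rel (fρ H 1 j) 1
  | delta_idem (g : G) (x : ℤ) : Rel (fδ H g x * fδ H g x) (fδ H g x)
  | delta_orth (g₁ g₂ : G) (x : ℤ) (hg : g₁ ≠ g₂) : Rel (fδ H g₁ x * fδ H g₂ x) 0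
  | rho_mul (h₁ h₂ : H) (j : ℤ) : Rel (fρ H h₁ j * fρ H h₂ j) (fρ H (h₁ * h₂) j)
  | delta_comm (g₁ g₂ : G) (x x' : ℤ) : Rel (fδ H g₁ x * fδ H g₂ x') (fδ H g₂ x' * fδ H g₁ x)
  | rho_delta_lt (h : H) (g : G) (j x : ℤ) (hjx : j < x) :
      Rel (fρ H h j * fδ H g x) (fδ H (h * g) x * fρ H h j)
  | rho_delta_gt (h : H) (g : G) (j x : ℤ) (hjx : x ≤ j) :
      Rel (fρ H h j * fδ H g x) (fδ H g x * fρ H h j)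
  | rho_rho (h₁ h₂ : H) (j j' : ℤ) (hj : j' < j) :
      Rel (fρ H h₁ j * fρ H h₂ j') (fρ H h₂ j' * fρ H (h₂⁻¹ * h₁ * h₂) j)

/-- The local field algebra `F_{H,loc}`: the unital associative complex algebra with these generators
and relations. -/
def LocAlg : Type _ := RingQuot (Rel H)

instance : Ring (LocAlg H) := inferInstanceAs (Ring (RingQuot (Rel H)))

instance : Algebra ℂ (LocAlg H) := inferInstanceAs (Algebra ℂ (RingQuot (Rel H)))

/-- The quotient map from the free algebra. -/
def mk : FreeAlgebra ℂ (Gen H) →ₐ[ℂ] LocAlg H := RingQuot.mkAlgHom ℂ (Rel H)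

/-- `δ_g(x) ∈ F_{H,loc}`. -/
def δ (g : G) (x : ℤ) : LocAlg H := mk H (fδ H g x)

/-- `ρ_h(j + 1/2) ∈ F_{H,loc}`. -/
def ρ (h : H) (j : ℤ) : LocAlg H := mk H (fρ H h j)

variable {H}

theorem mk_rel {a b : FreeAlgebra ℂ (Gen H)} (h : Rel H a b) : mk H a = mk H b :=
  RingQuot.mkAlgHom_rel ℂ h

theorem δ_sum (x : ℤ) : ∑ g : G, δ H g x = 1 := by
  simpa [δ] using mk_rel (Rel.delta_sum (H := H) x)

theorem ρ_one (j : ℤ) : ρ H 1 j = 1 := by simpa [ρ] using mk_rel (Rel.rho_one (H := H) j)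

theorem δ_idem (g : G) (x : ℤ) : δ H g x * δ H g x = δ H g x := by
  simpa [δ] using mk_rel (Rel.delta_idem (H := H) g x)

theorem δ_orth {g₁ g₂ : G} (x : ℤ) (hg : g₁ ≠ g₂) : δ H g₁ x * δ H g₂ x = 0 := by
  simpa [δ] using mk_rel (Rel.delta_orth (H := H) g₁ g₂ x hg)

theorem ρ_mul (h₁ h₂ : H) (j : ℤ) : ρ H h₁ j * ρ H h₂ j = ρ H (h₁ * h₂) j := by
  simpa [ρ] using mk_rel (Rel.rho_mul (H := H) h₁ h₂ j)

theorem δ_comm (g₁ g₂ : G) (x x' : ℤ) : δ H g₁ x * δ H g₂ x' = δ H g₂ x' * δ H g₁ x := by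
  simpa [δ] using mk_rel (Rel.delta_comm (H := H) g₁ g₂ x x')

theorem ρ_δ_lt (h : H) (g : G) {j x : ℤ} (hjx : j < x) :
    ρ H h j * δ H g x = δ H (h * g) x * ρ H h j := by
  simpa [δ, ρ] using mk_rel (Rel.rho_delta_lt (H := H) h g j x hjx)

theorem ρ_δ_gt (h : H) (g : G) {j x : ℤ} (hjx : x ≤ j) :
    ρ H h j * δ H g x = δ H g x * ρ H h j := by
  simpa [δ, ρ] using mk_rel (Rel.rho_delta_gt (H := H) h g j x hjx)

theorem ρ_ρ (h₁ h₂ : H) {j j' : ℤ} (hj : j' < j) :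
    ρ H h₁ j * ρ H h₂ j' = ρ H h₂ j' * ρ H (h₂⁻¹ * h₁ * h₂) j := by
  simpa [ρ] using mk_rel (Rel.rho_rho (H := H) h₁ h₂ j j' hj)

theorem mk_surj : Function.Surjective (mk H) := RingQuot.mkAlgHom_surjective ℂ (Rel H)

theorem LocAlg.induction {p : LocAlg H → Prop} (hc : ∀ c : ℂ, p (algebraMap ℂ _ c))
    (hδ : ∀ g x, p (δ H g x)) (hρ : ∀ h j, p (ρ H h j)) (hm : ∀ a b, p a → p b → p (a * b))
    (ha : ∀ a b, p a → p b → p (a + b)) (a : LocAlg H) : p a := by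
  obtain ⟨a, rfl⟩ := mk_surj a
  induction a using FreeAlgebra.induction with
  | grade0 r => simpa using hc r
  | grade1 s =>
    cases s with
    | delta g x => exact hδ g x
    | rho h j => exact hρ h j
  | mul a b h1 h2 => simpa using hm _ _ h1 h2
  | add a b h1 h2 => simpa using ha _ _ h1 h2

/-- Two families of elements satisfying the relations define an algebra homomorphism. -/
def liftAlg {B : Type*} [Ring B] [Algebra ℂ B] (d : G → ℤ → B) (r : H → ℤ → B)
    (delta_sum : ∀ x, ∑ g : G, d g x = 1) (rho_one : ∀ j, r 1 j = 1)
    (delta_idem : ∀ g x, d g x * d g x = d g x)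
    (delta_orth : ∀ g₁ g₂ x, g₁ ≠ g₂ → d g₁ x * d g₂ x = 0)
    (rho_mul : ∀ h₁ h₂ j, r h₁ j * r h₂ j = r (h₁ * h₂) j)
    (delta_comm : ∀ g₁ g₂ x x', d g₁ x * d g₂ x' = d g₂ x' * d g₁ x)
    (rho_delta_lt : ∀ (h : H) (g : G) (j x : ℤ), j < x → r h j * d g x = d (h * g) x * r h j)
    (rho_delta_gt : ∀ (h : H) (g : G) (j x : ℤ), x ≤ j → r h j * d g x = d g x * r h j)
    (rho_rho : ∀ h₁ h₂ j j', j' < j → r h₁ j * r h₂ j' = r h₂ j' * r (h₂⁻¹ * h₁ * h₂) j) :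
    LocAlg H →ₐ[ℂ] B :=
  RingQuot.liftAlgHom ℂ ⟨FreeAlgebra.lift ℂ (fun s => match s with
    | Gen.delta g x => d g x
    | Gen.rho h j => r h j), by
      intro a b hab
      cases hab with
      | delta_sum x => simpa using delta_sum x
      | rho_one j => simpa using rho_one j
      | delta_idem g x => simpa using delta_idem g x
      | delta_orth g₁ g₂ x hg => simpa using delta_orth g₁ g₂ x hg
      | rho_mul h₁ h₂ j => simpa using rho_mul h₁ h₂ j
      | delta_comm g₁ g₂ x x' => simpa using delta_comm g₁ g₂ x x'
      | rho_delta_lt h g j x hjx => simpa using rho_delta_lt h g j x hjx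
      | rho_delta_gt h g j x hjx => simpa using rho_delta_gt h g j x hjx
      | rho_rho h₁ h₂ j j' hj => simpa using rho_rho h₁ h₂ j j' hj⟩

section
variable {B : Type*} [Ring B] [Algebra ℂ B] {d : G → ℤ → B} {r : H → ℤ → B}
  (h1) (h2) (h3) (h4) (h5) (h6) (h7) (h8) (h9)

theorem liftAlg_δ (g : G) (x : ℤ) :
    liftAlg d r h1 h2 h3 h4 h5 h6 h7 h8 h9 (δ H g x) = d g x := by
  unfold liftAlg δ mk
  erw [RingQuot.liftAlgHom_mkAlgHom_apply]
  simp

theorem liftAlg_ρ (h : H) (j : ℤ) :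
    liftAlg d r h1 h2 h3 h4 h5 h6 h7 h8 h9 (ρ H h j) = r h j := by
  unfold liftAlg ρ mk
  erw [RingQuot.liftAlgHom_mkAlgHom_apply]
  simp
end

/-- `Bᵐᵒᵖ` as a complex algebra with the conjugated scalar action; linear maps into it are
antilinear maps into `B`. -/
abbrev conjOp (B : Type*) [Ring B] [Algebra ℂ B] : Algebra ℂ Bᵐᵒᵖ :=
  ((algebraMap ℂ Bᵐᵒᵖ).comp (starRingEnd ℂ)).toAlgebra' (fun c b => by
    simpa using Algebra.commutes (A := Bᵐᵒᵖ) (starRingEnd ℂ c) b)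

/-- The antilinear, antimultiplicative map with `δ_g(x) ↦ δ_g(x)` and `ρ_h(l) ↦ ρ_{h⁻¹}(l)`. -/
def starHom : LocAlg H →+* (LocAlg H)ᵐᵒᵖ :=
  letI := conjOp (LocAlg H)
  (liftAlg (fun g x => MulOpposite.op (δ H g x)) (fun h j => MulOpposite.op (ρ H h⁻¹ j))
    (fun x => by
      rw [← MulOpposite.op_one, ← δ_sum (H := H) x]
      exact (map_sum MulOpposite.opAddEquiv _ _).symm)
    (fun j => by rw [inv_one, ρ_one]; rfl)
    (fun g x => by rw [← MulOpposite.op_mul, δ_idem])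
    (fun g₁ g₂ x h => by rw [← MulOpposite.op_mul, δ_orth x h.symm]; rfl)
    (fun h₁ h₂ j => by rw [← MulOpposite.op_mul, ρ_mul, mul_inv_rev])
    (fun g₁ g₂ x x' => by rw [← MulOpposite.op_mul, δ_comm]; rfl)
    (fun h g j x hjx => by
      rw [← MulOpposite.op_mul, ← MulOpposite.op_mul, ρ_δ_lt _ _ hjx]
      simp)
    (fun h g j x hjx => by
      rw [← MulOpposite.op_mul, ← MulOpposite.op_mul, ρ_δ_gt _ _ hjx])
    (fun h₁ h₂ j j' hj => by
      rw [← MulOpposite.op_mul, ← MulOpposite.op_mul, ρ_ρ _ _ hj]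
      congr 3
      group)
    : LocAlg H →ₐ[ℂ] (LocAlg H)ᵐᵒᵖ).toRingHom

theorem starHom_δ (g : G) (x : ℤ) : starHom (δ H g x) = MulOpposite.op (δ H g x) := by
  let _ := conjOp (LocAlg H)
  exact liftAlg_δ (H := H) _ _ _ _ _ _ _ _ _ g x

theorem starHom_ρ (h : H) (j : ℤ) : starHom (ρ H h j) = MulOpposite.op (ρ H h⁻¹ j) := by
  let _ := conjOp (LocAlg H)
  exact liftAlg_ρ (H := H) _ _ _ _ _ _ _ _ _ h j

theorem starHom_algebraMap (c : ℂ) :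
    starHom (algebraMap ℂ (LocAlg H) c) = MulOpposite.op (algebraMap ℂ (LocAlg H) (star c)) := by
  let _ := conjOp (LocAlg H)
  exact AlgHom.commutes (liftAlg (H := H) _ _ _ _ _ _ _ _ _ _ _) c

/-- The *-operation on `F_{H,loc}`. -/
instance : StarRing (LocAlg H) where
  star a := (starHom a).unop
  star_involutive a := by
    induction a using LocAlg.induction with
    | hc c => simp [starHom_algebraMap]
    | hδ g x => simp [starHom_δ]
    | hρ h j => simp [starHom_ρ]
    | hm a b h1 h2 => simp [h1, h2]
    | ha a b h1 h2 => simp [h1, h2]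
  star_mul a b := by simp
  star_add a b := by simp

theorem star_def (a : LocAlg H) : star a = (starHom a).unop := rfl

theorem star_δ (g : G) (x : ℤ) : star (δ H g x) = δ H g x := by simp [star_def, starHom_δ]

theorem star_ρ (h : H) (j : ℤ) : star (ρ H h j) = ρ H h⁻¹ j := by simp [star_def, starHom_ρ]

theorem star_algebraMap (c : ℂ) :
    star (algebraMap ℂ (LocAlg H) c) = algebraMap ℂ (LocAlg H) (star c) := by
  simp [star_def, starHom_algebraMap]

instance : StarModule ℂ (LocAlg H) where
  star_smul c a := by
    rw [Algebra.smul_def, star_mul, star_algebraMap, Algebra.smul_def, Algebra.commutes]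

end LocalAlgebra

section Operators

open scoped Classical in
/-- On `ℓ²(C)`: the operator `(T ψ)(c) = ψ(e c)` if `c ∈ P` and `(T ψ)(c) = 0` otherwise, for a
permutation `e` of `C`. -/
def permOp {C : Type*} (P : Set C) (e : Equiv.Perm C) :
    lp (fun _ : C => ℂ) 2 →L[ℂ] lp (fun _ : C => ℂ) 2 :=
  LinearMap.mkContinuous
    { toFun := fun ψ => ⟨fun c => if c ∈ P then ψ (e c) else 0, by
        have h := (lp.memℓp ψ).summable (by norm_num)
        refine memℓp_gen ?_
        refine Summable.of_nonneg_of_le (fun c => by positivity) (fun c => ?_)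
          (h.comp_injective e.injective)
        by_cases hc : c ∈ P <;> simp [hc]⟩
      map_add' := fun ψ φ => by
        ext c
        change (if c ∈ P then (ψ + φ) (e c) else 0)
          = (if c ∈ P then ψ (e c) else 0) + (if c ∈ P then φ (e c) else 0)
        by_cases hc : c ∈ P <;> simp [hc]
      map_smul' := fun a ψ => by
        ext c
        by_cases hc : c ∈ P <;> simp [hc] } 1 (fun ψ => by
    have h := (lp.memℓp ψ).summable (p := 2) (by norm_num)
    have h2 : (0 : ℝ) < (2 : ENNReal).toReal := by norm_num
    refine lp.norm_le_of_tsum_le h2 (by positivity) ?_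
    rw [one_mul, lp.norm_rpow_eq_tsum h2, ← e.tsum_eq (fun c => ‖ψ c‖ ^ (2 : ENNReal).toReal)]
    have key : ∀ c, ‖(if c ∈ P then ψ (e c) else 0 : ℂ)‖ ^ (2 : ENNReal).toReal
        ≤ ‖ψ (e c)‖ ^ (2 : ENNReal).toReal := fun c => by
      by_cases hc : c ∈ P <;> simp [hc]
    have hs := h.comp_injective e.injective
    exact Summable.tsum_le_tsum key
      (Summable.of_nonneg_of_le (fun c => by positivity) key hs) hs)

variable {C : Type*}

open scoped Classical in
theorem permOp_apply (P : Set C) (e : Equiv.Perm C) (ψ : lp (fun _ : C => ℂ) 2) (c : C) :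
    permOp P e ψ c = if c ∈ P then ψ (e c) else 0 := rfl

theorem permOp_norm_le (P : Set C) (e : Equiv.Perm C) : ‖permOp P e‖ ≤ 1 :=
  LinearMap.mkContinuous_norm_le _ zero_le_one _

theorem permOp_mul (P Q : Set C) (e f : Equiv.Perm C) :
    permOp P e * permOp Q f = permOp (P ∩ e ⁻¹' Q) (f * e) := by
  ext ψ c
  by_cases hc : c ∈ P <;> by_cases hd : e c ∈ Q <;>
    simp [permOp_apply, hc, hd]

theorem permOp_one : permOp (Set.univ : Set C) 1 = 1 := by
  ext ψ c
  simp [permOp_apply]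

theorem permOp_empty (e : Equiv.Perm C) : permOp (∅ : Set C) e = 0 := by
  ext ψ c
  simp [permOp_apply]

theorem permOp_star (P : Set C) (e : Equiv.Perm C) :
    star (permOp P e) = permOp (e.symm ⁻¹' P) e.symm := by
  rw [ContinuousLinearMap.star_eq_adjoint]
  symm
  rw [ContinuousLinearMap.eq_adjoint_iff]
  intro ψ φ
  rw [lp.inner_eq_tsum, lp.inner_eq_tsum, ← e.tsum_eq]
  refine tsum_congr fun c => ?_
  by_cases hc : c ∈ P <;> simp [permOp_apply, hc]

theorem permOp_sum {ι : Type*} [Fintype ι] (f : C → ι) :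
    ∑ i, permOp {c | f c = i} 1 = 1 := by
  ext ψ c
  rw [_root_.sum_apply, lp.coeFn_sum]
  erw [Finset.sum_apply]
  rw [Finset.sum_eq_single (f c)]
  · simp [permOp_apply]
  · intro i _ hi
    simp [permOp_apply, hi.symm]
  · simp

end Operators

section Representation

variable {G : Type*} [Group G] [Fintype G] (H : Subgroup G)

/-- Spin configurations on `ℤ`, together with one more spin, with values in `H`, at `+∞`. -/
abbrev Conf : Type _ := (ℤ → G) × H

/-- Bounded operators on `ℓ²` of the configurations. -/
abbrev Op : Type _ := lp (fun _ : Conf H => ℂ) 2 →L[ℂ] lp (fun _ : Conf H => ℂ) 2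

variable {H}

/-- The kink at `j + 1/2`: it is `h` to the right of `j + 1/2` (and at `+∞`) and `1` to the left. -/
def kink (h : H) (j : ℤ) : Conf H := (fun x => if j < x then (h : G) else 1, h)

theorem kink_mul (h₁ h₂ : H) (j : ℤ) : kink h₁ j * kink h₂ j = kink (h₁ * h₂) j := by
  ext x
  · by_cases hx : j < x <;> simp [kink, hx]
  · simp [kink]

theorem kink_one (j : ℤ) : kink (1 : H) j = 1 := by
  ext x
  · simp [kink]
  · simp [kink]

theorem kink_kink (h₁ h₂ : H) {j j' : ℤ} (hj : j' < j) :
    kink h₁ j * kink h₂ j' = kink h₂ j' * kink (h₂⁻¹ * h₁ * h₂) j := by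
  ext x
  · by_cases hx : j < x
    · have : j' < x := hj.trans hx
      simp [kink, hx, this, mul_assoc]
    · simp [kink, hx]
  · simp [kink, mul_assoc]

/-- `δ_g(x)` is represented by the indicator function of the configurations with spin `g` at `x`. -/
def opδ (g : G) (x : ℤ) : Op H := permOp {c | c.1 x = g} 1

/-- Translation of the basis vectors of `ℓ²` by an element of the group of configurations. -/
def opL (m : Conf H) : Op H := permOp Set.univ (Equiv.mulLeft m⁻¹)

theorem opL_mul (m n : Conf H) : opL m * opL n = opL (m * n) := by
  rw [opL, opL, permOp_mul, opL]
  congr 1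
  · simp
  · ext1 c
    simp

theorem opL_one : opL (1 : Conf H) = 1 := by
  rw [opL, ← permOp_one]
  congr 1
  ext1 c
  simp

theorem opδ_mul (g₁ g₂ : G) (x y : ℤ) :
    (opδ g₁ x * opδ g₂ y : Op H) = permOp {c | c.1 x = g₁ ∧ c.1 y = g₂} 1 := by
  rw [opδ, opδ, permOp_mul]
  rfl

theorem opL_δ (m : Conf H) (g : G) (x : ℤ) : opL m * opδ g x = opδ (m.1 x * g) x * opL m := by
  rw [opL, opδ, opδ, permOp_mul, permOp_mul]
  congr 1
  ext c
  simp [inv_mul_eq_iff_eq_mul]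

/-- The representation of `F_{H,loc}` on `ℓ²` of the configurations: `δ_g(x)` is multiplication by
the indicator function of `{σ | σ(x) = g}` and `ρ_h(l)` multiplies all the spins to the right
of `l` by `h` from the left. -/
def repAlg : LocAlg H →ₐ[ℂ] Op H :=
  liftAlg opδ (fun h j => opL (kink h j))
    (fun x => permOp_sum (fun c : Conf H => c.1 x))
    (fun j => by rw [kink_one, opL_one])
    (fun g x => by
      rw [opδ_mul]
      simp [opδ])
    (fun g₁ g₂ x h => by
      rw [opδ_mul, ← permOp_empty 1]
      congr 1
      ext c
      simp only [Set.mem_ofPred_eq, Set.mem_empty_iff_false, iff_false, not_and]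
      intro h1 h2
      exact h (h1.symm.trans h2))
    (fun h₁ h₂ j => by rw [opL_mul, kink_mul])
    (fun g₁ g₂ x x' => by
      rw [opδ_mul, opδ_mul]
      congr 1
      ext c
      exact and_comm)
    (fun h g j x hjx => by
      rw [opL_δ]
      simp [kink, hjx])
    (fun h g j x hjx => by
      rw [opL_δ]
      simp [kink, not_lt.2 hjx])
    (fun h₁ h₂ j j' hj => by rw [opL_mul, opL_mul, kink_kink _ _ hj])

theorem repAlg_δ (g : G) (x : ℤ) : repAlg (δ H g x) = opδ g x := liftAlg_δ _ _ _ _ _ _ _ _ _ g x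

theorem repAlg_ρ (h : H) (j : ℤ) : repAlg (ρ H h j) = opL (kink h j) :=
  liftAlg_ρ _ _ _ _ _ _ _ _ _ h j

theorem opδ_star (g : G) (x : ℤ) : star (opδ g x : Op H) = opδ g x := by
  rw [opδ, permOp_star]
  rfl

theorem opL_star (m : Conf H) : star (opL m) = opL m⁻¹ := by
  rw [opL, permOp_star]
  simp [opL]

theorem kink_inv (h : H) (j : ℤ) : (kink h j)⁻¹ = kink h⁻¹ j := by
  rw [inv_eq_iff_mul_eq_one, kink_mul, mul_inv_cancel, kink_one]

/-- The representation of `F_{H,loc}` as a *-homomorphism. -/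
def rep : LocAlg H →⋆ₐ[ℂ] Op H where
  __ := repAlg (H := H)
  map_star' a := by
    change repAlg (star a) = star (repAlg a)
    induction a using LocAlg.induction with
    | hc c => rw [star_algebraMap, AlgHom.commutes, AlgHom.commutes, algebraMap_star_comm]
    | hδ g x => rw [star_δ, repAlg_δ, opδ_star]
    | hρ h j => rw [star_ρ, repAlg_ρ, repAlg_ρ, opL_star, kink_inv]
    | hm a b h1 h2 => rw [star_mul, map_mul, map_mul, star_mul, h1, h2]
    | ha a b h1 h2 => rw [star_add, map_add, map_add, star_add, h1, h2]

theorem rep_δ (g : G) (x : ℤ) : rep (δ H g x) = opδ g x := repAlg_δ g x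

theorem rep_ρ (h : H) (j : ℤ) : rep (ρ H h j) = opL (kink h j) := repAlg_ρ h j

end Representation

section Action

variable {G : Type*} [Group G] [Fintype G] {H : Subgroup G} [H.Normal]

/-- `g h g⁻¹` for `g ∈ G` and `h ∈ H`. -/
abbrev cj (g : G) (h : H) : H := MulAut.conjNormal g h

theorem cj_one (g : G) : cj g (1 : H) = 1 := MulEquiv.map_one _

theorem cj_mul (g : G) (h k : H) : cj g (h * k) = cj g h * cj g k := MulEquiv.map_mul _ _ _

/-- For fixed `g ∈ G`, all the maps `F ↦ (h, g)(F)`, `h ∈ H`, at once: the homomorphism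
`F ↦ ∑ₕ (h, g)(F) ⊗ h` from `F_{H,loc}` to `F_{H,loc} ⊗ ℂH`. Its multiplicativity is the rule
`(h, g)(F₁ F₂) = ∑ₜ (t, g)(F₁) (t⁻¹ h, g)(F₂)`. -/
def coact (g : G) : LocAlg H →ₐ[ℂ] MonoidAlgebra (LocAlg H) H :=
  liftAlg (fun f x => MonoidAlgebra.single 1 (δ H (g * f) x))
    (fun t j => MonoidAlgebra.single (cj g t) (ρ H (cj g t) j))
    (fun x => by
      rw [MonoidAlgebra.one_def, ← δ_sum (H := H) x, 
        ← Equiv.sum_comp (Equiv.mulLeft g) (fun f => δ H f x)]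
      exact (map_sum (MonoidAlgebra.singleAddHom (R := LocAlg H) (1 : H)) _ _).symm)
    (fun j => by rw [cj_one, ρ_one]; rfl)
    (fun f x => by rw [MonoidAlgebra.single_mul_single, δ_idem, mul_one])
    (fun f₁ f₂ x h => by
      rw [MonoidAlgebra.single_mul_single, δ_orth x (by simpa using h), MonoidAlgebra.single_zero])
    (fun h₁ h₂ j => by rw [MonoidAlgebra.single_mul_single, ρ_mul, cj_mul])
    (fun f₁ f₂ x x' => by
      rw [MonoidAlgebra.single_mul_single, MonoidAlgebra.single_mul_single, δ_comm])
    (fun h f j x hjx => by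
      rw [MonoidAlgebra.single_mul_single, MonoidAlgebra.single_mul_single, ρ_δ_lt _ _ hjx]
      simp [mul_assoc])
    (fun h f j x hjx => by
      rw [MonoidAlgebra.single_mul_single, MonoidAlgebra.single_mul_single, ρ_δ_gt _ _ hjx]
      simp)
    (fun h₁ h₂ j j' hj => by
      rw [MonoidAlgebra.single_mul_single, MonoidAlgebra.single_mul_single, ρ_ρ _ _ hj]
      simp [mul_assoc])

/-- The action of the basis element `(h, g)` of `D(H;G)` on `F_{H,loc}`. -/
def actLoc (h : H) (g : G) : LocAlg H →ₗ[ℂ] LocAlg H where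
  toFun a := (coact g a).coeff h
  map_add' a b := by simp
  map_smul' c a := by simp

theorem coact_δ (g f : G) (x : ℤ) :
    coact g (δ H f x) = MonoidAlgebra.single 1 (δ H (g * f) x) := liftAlg_δ _ _ _ _ _ _ _ _ _ f x

theorem coact_ρ (g : G) (t : H) (j : ℤ) :
    coact g (ρ H t j) = MonoidAlgebra.single (cj g t) (ρ H (cj g t) j) :=
  liftAlg_ρ _ _ _ _ _ _ _ _ _ t j

open scoped Classical in
/-- `(h, g) δ_f(x) = δ_{h,e} δ_{gf}(x)`. -/
theorem actLoc_δ (h : H) (g f : G) (x : ℤ) :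
    actLoc h g (δ H f x) = if h = 1 then δ H (g * f) x else 0 := by
  change (coact g (δ H f x)).coeff h = _
  rw [coact_δ, MonoidAlgebra.coeff_single, Finsupp.single_apply]
  simp [eq_comm]

open scoped Classical in
/-- `(h, g) ρ_t(l) = δ_{h, g t g⁻¹} ρ_h(l)`. -/
theorem actLoc_ρ (h : H) (g : G) (t : H) (j : ℤ) :
    actLoc h g (ρ H t j) = if (h : G) = g * t * g⁻¹ then ρ H h j else 0 := by
  change (coact g (ρ H t j)).coeff h = _
  rw [coact_ρ, MonoidAlgebra.coeff_single, Finsupp.single_apply]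
  by_cases hh : cj g t = h
  · rw [if_pos hh, if_pos, hh]
    rw [← hh, MulAut.conjNormal_apply]
  · rw [if_neg hh, if_neg]
    intro h2
    exact hh (Subtype.ext (by rw [MulAut.conjNormal_apply, h2]))

open scoped Classical in
/-- `(h, g)(c I) = ε(h, g) c I`. -/
theorem actLoc_algebraMap (h : H) (g : G) (c : ℂ) :
    actLoc h g (algebraMap ℂ (LocAlg H) c) = if h = 1 then algebraMap ℂ (LocAlg H) c else 0 := by
  change (coact g _).coeff h = _
  rw [AlgHom.commutes, MonoidAlgebra.coe_algebraMap]
  simp [Finsupp.single_apply, eq_comm]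

/-- `(h, g)(F₁ F₂) = ∑ₜ (t, g)(F₁) (t⁻¹ h, g)(F₂)`. -/
theorem actLoc_mul [Fintype H] (h : H) (g : G) (a b : LocAlg H) :
    actLoc h g (a * b) = ∑ t : H, actLoc t g a * actLoc (t⁻¹ * h) g b := by
  change (coact g (a * b)).coeff h = _
  rw [map_mul, MonoidAlgebra.coeff_mul_apply_left, Finsupp.sum_fintype]
  · rfl
  · simp

open scoped Classical in
/-- `(h₁, g₁)((h₂, g₂)(F)) = δ_{h₁ g₁, g₁ h₂} (h₁, g₁ g₂)(F)`: compatibility with the product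
of the crossed product `D(H;G)`. -/
theorem actLoc_actLoc (h₁ h₂ : H) (g₁ g₂ : G) (a : LocAlg H) :
    actLoc h₁ g₁ (actLoc h₂ g₂ a)
      = if (h₁ : G) * g₁ = g₁ * h₂ then actLoc h₁ (g₁ * g₂) a else 0 := by
  have : Fintype H := Fintype.ofFinite H
  have hiff : ∀ h k : H, (h : G) * g₁ = g₁ * k ↔ h = cj g₁ k := fun h k => by
    rw [Subtype.ext_iff, MulAut.conjNormal_apply, eq_mul_inv_iff_mul_eq]
  simp only [hiff]
  induction a using LocAlg.induction generalizing h₁ h₂ with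
  | hc c =>
    rw [actLoc_algebraMap, actLoc_algebraMap]
    by_cases h : h₂ = 1
    · rw [if_pos h, h, cj_one, actLoc_algebraMap]
      split_ifs <;> rfl
    · rw [if_neg h, map_zero]
      split_ifs with h1 h2
      · exact absurd ((MulAut.conjNormal g₁).injective ((h1.symm.trans h2).trans (cj_one g₁).symm)) h
      · rfl
      · rfl
  | hδ f x =>
    rw [actLoc_δ, actLoc_δ]
    by_cases h : h₂ = 1
    · rw [if_pos h, h, cj_one, actLoc_δ, mul_assoc]
      split_ifs <;> rfl
    · rw [if_neg h, map_zero]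
      split_ifs with h1 h2
      · exact absurd ((MulAut.conjNormal g₁).injective ((h1.symm.trans h2).trans (cj_one g₁).symm)) h
      · rfl
      · rfl
  | hρ t j =>
    have e : ∀ (h t : H) (g : G), (h : G) = g * t * g⁻¹ ↔ h = cj g t := fun h t g => by
      rw [Subtype.ext_iff, MulAut.conjNormal_apply]
    have e2 : cj (g₁ * g₂) t = cj g₁ (cj g₂ t) := by
      rw [cj, _root_.map_mul]
      rfl
    rw [actLoc_ρ, actLoc_ρ]
    simp only [e, e2]
    by_cases h : h₂ = cj g₂ t
    · rw [if_pos h, h, actLoc_ρ]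
      simp only [e]
      split_ifs <;> rfl
    · rw [if_neg h, map_zero]
      split_ifs with h1 h2
      · exact absurd ((MulAut.conjNormal g₁).injective (h1.symm.trans h2)) h
      · rfl
      · rfl
  | hm a b ha hb =>
    rw [actLoc_mul, map_sum]
    simp only [actLoc_mul, ha, hb]
    rw [Finset.sum_comm]
    have key : ∀ s t : H, ((if s = cj g₁ t then actLoc s (g₁ * g₂) a else 0)
        * if s⁻¹ * h₁ = cj g₁ (t⁻¹ * h₂) then actLoc (s⁻¹ * h₁) (g₁ * g₂) b else 0)
        = if t = (MulAut.conjNormal g₁).symm s then (if h₁ = cj g₁ h₂ then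
          actLoc s (g₁ * g₂) a * actLoc (s⁻¹ * h₁) (g₁ * g₂) b else 0) else 0 := fun s t => by
      by_cases hs : s = cj g₁ t
      · subst hs
        simp
      · rw [if_neg hs, zero_mul, if_neg]
        rintro rfl
        simp at hs
    simp only [key]
    split_ifs <;> simp
  | ha a b ha hb =>
    rw [map_add, map_add, ha, hb, map_add]
    split_ifs <;> simp

/-- The projection onto the configurations with spin `k` at `+∞`. -/
def opQ (k : H) : Op H := permOp {c | c.2 = k} 1

theorem opQ_sum [Fintype H] : ∑ k : H, (opQ k : Op H) = 1 := permOp_sum (fun c : Conf H => c.2)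

open scoped Classical in
theorem opQ_mul (k l : H) : (opQ k * opQ l : Op H) = if k = l then opQ k else 0 := by
  rw [opQ, opQ, permOp_mul]
  by_cases h : k = l
  · subst h
    simp
  · rw [if_neg h, ← permOp_empty 1]
    congr 1
    ext c
    simp only [Set.mem_inter_iff, Set.mem_preimage, Equiv.Perm.coe_one, id_eq, Set.mem_ofPred_eq,
      Set.mem_empty_iff_false, iff_false, not_and]
    intro h1 h2
    exact h (h1.symm.trans h2)

/-- The component of degree `h` of an operator. -/
def opE [Fintype H] (h : H) (X : Op H) : Op H := ∑ k : H, opQ (h * k) * X * opQ k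

theorem opE_norm_le [Fintype H] (h : H) (X : Op H) : ‖opE h X‖ ≤ Fintype.card H * ‖X‖ := by
  refine (norm_sum_le _ _).trans ?_
  refine (Finset.sum_le_sum (g := fun _ => ‖X‖) fun k _ => ?_).trans (by simp)
  calc ‖opQ (h * k) * X * opQ k‖ ≤ ‖opQ (h * k)‖ * ‖X‖ * ‖opQ k‖ :=
        (norm_mul_le _ _).trans (by gcongr; exact norm_mul_le _ _)
    _ ≤ 1 * ‖X‖ * 1 := by gcongr <;> exact permOp_norm_le _ _
    _ = ‖X‖ := by ring

open scoped Classical in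
theorem opE_of_comm [Fintype H] (h d : H) (X : Op H) (hX : ∀ k, X * opQ k = opQ (d * k) * X) :
    opE h X = if h = d then X else 0 := by
  have key : ∀ k, opQ (h * k) * X * opQ k = if h = d then opQ (h * k) * X else 0 := fun k => by
    rw [mul_assoc, hX, ← mul_assoc, opQ_mul]
    by_cases hd : h = d <;> simp [hd]
  rw [opE, Finset.sum_congr rfl fun k _ => key k]
  by_cases hd : h = d
  · simp only [hd, if_true]
    have := Equiv.sum_comp (Equiv.mulLeft d) (fun k => (opQ k : Op H))
    simp only [Equiv.coe_mulLeft] at this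
    rw [← Finset.sum_mul, this, opQ_sum, one_mul]
  · simp [hd]

theorem opE_mul [Fintype H] (h : H) (X Y : Op H) :
    opE h (X * Y) = ∑ t : H, opE t X * opE (t⁻¹ * h) Y := by
  classical
  have key : ∀ t : H, opE t X * opE (t⁻¹ * h) Y
      = ∑ k : H, opQ (h * k) * X * opQ (t⁻¹ * h * k) * Y * opQ k := fun t => by
    rw [opE, opE, Finset.sum_mul_sum, Finset.sum_comm]
    refine Finset.sum_congr rfl fun k _ => ?_
    rw [Finset.sum_eq_single (t⁻¹ * h * k)]
    · have : opQ (t⁻¹ * h * k) * opQ (t⁻¹ * h * k) = (opQ (t⁻¹ * h * k) : Op H) := by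
        rw [opQ_mul, if_pos rfl]
      rw [show t * (t⁻¹ * h * k) = h * k by group]
      calc _ = opQ (h * k) * X * (opQ (t⁻¹ * h * k) * opQ (t⁻¹ * h * k)) * Y * opQ k := by
            simp only [mul_assoc]
        _ = _ := by rw [this]
    · intro l _ hl
      calc _ = opQ (t * l) * X * (opQ l * opQ (t⁻¹ * h * k)) * Y * opQ k := by
            simp only [mul_assoc]
        _ = _ := by rw [opQ_mul, if_neg hl]; simp
    · simp
  rw [Finset.sum_congr rfl fun t _ => key t, Finset.sum_comm, opE]
  refine Finset.sum_congr rfl fun k _ => ?_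
  have : ∑ t : H, (opQ (t⁻¹ * h * k) : Op H) = 1 := by
    rw [← opQ_sum (H := H)]
    exact Equiv.sum_comp ((Equiv.inv H).trans ((Equiv.mulRight h).trans (Equiv.mulRight k)))
      (fun t => (opQ t : Op H))
  rw [← Finset.sum_mul, ← Finset.sum_mul, ← Finset.mul_sum, this, mul_one, mul_assoc _ X Y]

/-- The action of `g ∈ G` on configurations: left multiplication by `g` of the spins, and
conjugation by `g` of the spin at `+∞`. -/
def confPerm (g : G) : Equiv.Perm (Conf H) :=
  Equiv.prodCongr (Equiv.piCongrRight fun _ => Equiv.mulLeft g) (MulAut.conjNormal g).toEquiv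

theorem confPerm_mul (g k : G) : confPerm (H := H) (g * k) = confPerm g * confPerm k := by
  ext c
  · simp [confPerm, mul_assoc]
  · simp [confPerm]

theorem confPerm_one : confPerm (H := H) 1 = 1 := by
  ext c
  · simp [confPerm]
  · simp [confPerm]

/-- The unitary operator of `confPerm`. -/
def opV (g : G) : Op H := permOp Set.univ (confPerm g⁻¹)

theorem opV_mul (g k : G) : (opV g * opV k : Op H) = opV (g * k) := by
  rw [opV, opV, permOp_mul, opV, mul_inv_rev, confPerm_mul]
  simp

theorem opV_inv (g : G) : (opV g * opV g⁻¹ : Op H) = 1 := by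
  rw [opV_mul, mul_inv_cancel, opV, inv_one, confPerm_one, permOp_one]

theorem opV_δ (g f : G) (x : ℤ) : (opV g * opδ f x : Op H) = opδ (g * f) x * opV g := by
  rw [opV, opδ, opδ, permOp_mul, permOp_mul]
  congr 1
  ext c
  simp [confPerm, inv_mul_eq_iff_eq_mul]

theorem opV_L (g : G) (t : H) (j : ℤ) :
    opV g * opL (kink t j) = opL (kink (cj g t) j) * opV g := by
  rw [opV, opL, opL, permOp_mul, permOp_mul]
  congr 1
  ext c
  · by_cases hx : j < ‹ℤ› <;> simp [confPerm, kink, hx, mul_assoc]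
  · simp [confPerm, kink, mul_assoc]

theorem opδ_Q (g : G) (x : ℤ) (k : H) : (opδ g x * opQ k : Op H) = opQ k * opδ g x := by
  rw [opQ, opδ, permOp_mul, permOp_mul]
  congr 1
  ext c
  exact and_comm

theorem opL_Q (h : H) (j : ℤ) (k : H) :
    opL (kink h j) * opQ k = opQ (h * k) * opL (kink h j) := by
  rw [opQ, opQ, opL, permOp_mul, permOp_mul]
  congr 1
  ext c
  simp [kink, inv_mul_eq_iff_eq_mul]

theorem rep_actLoc [Fintype H] (h : H) (g : G) (a : LocAlg H) :
    rep (actLoc h g a) = opE h (opV g * rep a * opV g⁻¹) := by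
  classical
  induction a using LocAlg.induction generalizing h with
  | hc c =>
    rw [actLoc_algebraMap, AlgHomClass.commutes, ← Algebra.commutes, mul_assoc, opV_inv, mul_one,
      opE_of_comm h 1 _ (fun k => by rw [one_mul, Algebra.commutes])]
    split_ifs
    · exact AlgHomClass.commutes _ _
    · exact map_zero _
  | hδ f x =>
    rw [actLoc_δ, rep_δ, opV_δ, mul_assoc, opV_inv, mul_one,
      opE_of_comm h 1 _ (fun k => by rw [one_mul, opδ_Q])]
    split_ifs
    · exact rep_δ _ _
    · exact map_zero _
  | hρ t j =>
    rw [actLoc_ρ, rep_ρ, opV_L, mul_assoc _ (opV g), opV_inv, mul_one, opE_of_comm h (cj g t) _ (opL_Q _ _)]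
    have : (h : G) = g * t * g⁻¹ ↔ h = cj g t := by
      rw [Subtype.ext_iff, MulAut.conjNormal_apply]
    simp only [this]
    split_ifs with hh
    · rw [rep_ρ, ← hh]
    · exact map_zero _
  | hm a b h1 h2 =>
    have hi : opV g⁻¹ * opV g = (1 : Op H) := by simpa using opV_inv (H := H) g⁻¹
    rw [actLoc_mul, map_sum, map_mul]
    have : opV g * (rep a * rep b) * opV g⁻¹
        = (opV g * rep a * opV g⁻¹) * (opV g * rep b * opV g⁻¹) := by
      calc _ = opV g * rep a * 1 * rep b * opV g⁻¹ := by simp only [mul_assoc, mul_one]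
        _ = _ := by
          rw [← hi]
          simp only [mul_assoc]
    rw [this, opE_mul]
    refine Finset.sum_congr rfl fun t _ => ?_
    rw [map_mul, h1, h2]
  | ha a b h1 h2 =>
    rw [map_add, map_add, h1, h2, map_add]
    simp only [opE, mul_add, add_mul, Finset.sum_add_distrib]

theorem rep_actLoc_bound (h : H) (g : G) :
    ∃ c : ℝ, ∀ a : LocAlg H, ‖rep (actLoc h g a)‖ ≤ c * ‖rep a‖ := by
  have : Fintype H := Fintype.ofFinite H
  refine ⟨Fintype.card H, fun a => ?_⟩
  rw [rep_actLoc]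
  refine (opE_norm_le _ _).trans ?_
  gcongr
  calc ‖opV g * rep a * opV g⁻¹‖ ≤ ‖opV g‖ * ‖rep a‖ * ‖opV g⁻¹‖ :=
        (norm_mul_le _ _).trans (by gcongr; exact norm_mul_le _ _)
    _ ≤ 1 * ‖rep a‖ * 1 := by gcongr <;> exact permOp_norm_le _ _
    _ = ‖rep a‖ := by ring

end Action

section Faithful

variable {G : Type*} [Group G] [Fintype G] {H : Subgroup G}

/-- `δ_{τ(a)}(a) ⋯ δ_{τ(a+n-1)}(a+n-1)`. -/
def prodδ (H : Subgroup G) (a : ℤ) (τ : ℤ → G) : ℕ → LocAlg H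
  | 0 => 1
  | n + 1 => prodδ H a τ n * δ H (τ (a + n)) (a + n)

/-- `ρ_{h(a)}(a+1/2) ⋯ ρ_{h(a+n-1)}(a+n-1/2)`. -/
def prodρ (a : ℤ) (h : ℤ → H) : ℕ → LocAlg H
  | 0 => 1
  | n + 1 => prodρ a h n * ρ H (h (a + n)) (a + n)

/-- Pairs of functions which are trivial outside of `[a, a + n)`. -/
abbrev Idx (H : Subgroup G) (a : ℤ) (n : ℕ) : Type _ :=
  {p : (ℤ → G) × (ℤ → H) // ∀ x, ¬ (a ≤ x ∧ x < a + n) → p.1 x = 1 ∧ p.2 x = 1}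

/-- The ordered monomials. -/
def mono (a : ℤ) (n : ℕ) (p : (ℤ → G) × (ℤ → H)) : LocAlg H := prodδ H a p.1 n * prodρ a p.2 n

/-- The span of the ordered monomials. -/
def monoSpan (H : Subgroup G) (a : ℤ) (n : ℕ) : Submodule ℂ (LocAlg H) :=
  Submodule.span ℂ (Set.range fun p : Idx H a n => mono a n p.1)

theorem prodδ_congr {a : ℤ} {n : ℕ} {τ τ' : ℤ → G} (h : ∀ x, a ≤ x → x < a + n → τ x = τ' x) :
    prodδ H a τ n = prodδ H a τ' n := by
  induction n with
  | zero => rfl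
  | succ n ih =>
    rw [prodδ, prodδ, ih (fun x h1 h2 => h x h1 (by push_cast; omega)),
      h (a + n) (by omega) (by push_cast; omega)]

theorem prodρ_congr {a : ℤ} {n : ℕ} {τ τ' : ℤ → H} (h : ∀ x, a ≤ x → x < a + n → τ x = τ' x) :
    prodρ a τ n = prodρ a τ' n := by
  induction n with
  | zero => rfl
  | succ n ih =>
    rw [prodρ, prodρ, ih (fun x h1 h2 => h x h1 (by push_cast; omega)),
      h (a + n) (by omega) (by push_cast; omega)]

theorem mono_mem (a : ℤ) (n : ℕ) (p : (ℤ → G) × (ℤ → H)) : mono a n p ∈ monoSpan H a n := by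
  classical
  let q : (ℤ → G) × (ℤ → H) := (fun x => if a ≤ x ∧ x < a + n then p.1 x else 1,
    fun x => if a ≤ x ∧ x < a + n then p.2 x else 1)
  have : mono a n p = mono a n q := by
    rw [mono, mono, prodδ_congr (τ' := q.1), prodρ_congr (τ' := q.2)]
    · intro x h1 h2
      simp [q, h1, h2]
    · intro x h1 h2
      simp [q, h1, h2]
  rw [this]
  exact Submodule.subset_span ⟨⟨q, fun x hx => by simp only [q, if_neg hx, and_self]⟩, rfl⟩

theorem δ_prodδ_comm (g : G) (x a : ℤ) (τ : ℤ → G) (n : ℕ) :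
    δ H g x * prodδ H a τ n = prodδ H a τ n * δ H g x := by
  induction n with
  | zero => simp [prodδ]
  | succ n ih => rw [prodδ, ← mul_assoc, ih, mul_assoc, δ_comm, mul_assoc]

theorem δ_prodδ (g : G) {x a : ℤ} (τ : ℤ → G) {n : ℕ} (h1 : a ≤ x) (h2 : x < a + n) :
    δ H g x * prodδ H a τ n = prodδ H a τ n ∨ δ H g x * prodδ H a τ n = 0 := by
  induction n with
  | zero => simp at h2; omega
  | succ n ih =>
    by_cases hx : x = a + n
    · subst hx
      rw [prodδ, ← mul_assoc, δ_prodδ_comm, mul_assoc]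
      by_cases hg : g = τ (a + n)
      · left
        rw [← hg, δ_idem]
      · right
        rw [δ_orth _ hg, mul_zero]
    · rw [prodδ, ← mul_assoc]
      rcases ih (by push_cast at h2; omega) with h | h
      · left; rw [h]
      · right; rw [h, zero_mul]

theorem ρ_prodδ (k : H) (j a : ℤ) (τ : ℤ → G) (n : ℕ) :
    ρ H k j * prodδ H a τ n
      = prodδ H a (fun x => if j < x then k * τ x else τ x) n * ρ H k j := by
  induction n with
  | zero => simp [prodδ]
  | succ n ih =>
    rw [prodδ, prodδ, ← mul_assoc, ih, mul_assoc, mul_assoc]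
    congr 1
    by_cases hj : j < a + n
    · rw [ρ_δ_lt _ _ hj, if_pos hj]
    · rw [ρ_δ_gt _ _ (not_lt.1 hj), if_neg hj]

theorem ρ_prodρ_comm (k : H) {j a : ℤ} (h : ℤ → H) {n : ℕ} (hj : a + n ≤ j) :
    ∃ k' : H, ρ H k j * prodρ a h n = prodρ a h n * ρ H k' j := by
  induction n with
  | zero => exact ⟨k, by simp [prodρ]⟩
  | succ n ih =>
    push_cast at hj
    obtain ⟨k', hk⟩ := ih (by omega)
    refine ⟨(h (a + n))⁻¹ * k' * h (a + n), ?_⟩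
    rw [prodρ, ← mul_assoc, hk, mul_assoc (prodρ a h n), ρ_ρ _ _ (by omega), ← mul_assoc]

theorem ρ_prodρ (k : H) {j a : ℤ} (h : ℤ → H) {n : ℕ} (h1 : a ≤ j) (h2 : j < a + n) :
    ∃ h' : ℤ → H, ρ H k j * prodρ a h n = prodρ a h' n := by
  classical
  induction n with
  | zero => simp at h2; omega
  | succ n ih =>
    push_cast at h2
    by_cases hj : j = a + n
    · obtain ⟨k', hk⟩ := ρ_prodρ_comm k h hj.ge
      refine ⟨Function.update h (a + n) (k' * h (a + n)), ?_⟩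
      rw [prodρ, ← mul_assoc, hk, mul_assoc, hj, ρ_mul, prodρ, Function.update_self]
      congr 1
      refine prodρ_congr fun x _ hx => ?_
      rw [Function.update_of_ne (by omega)]
    · obtain ⟨h', hh⟩ := ih (by omega)
      refine ⟨Function.update h' (a + n) (h (a + n)), ?_⟩
      rw [prodρ, ← mul_assoc, hh, prodρ, Function.update_self]
      congr 1
      refine prodρ_congr fun x _ hx => ?_
      rw [Function.update_of_ne (by omega)]

theorem one_mem_span_prodδ (H : Subgroup G) (a : ℤ) (n : ℕ) :
    (1 : LocAlg H) ∈ Submodule.span ℂ (Set.range fun τ => prodδ H a τ n) := by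
  classical
  induction n with
  | zero => exact Submodule.subset_span ⟨fun _ => 1, rfl⟩
  | succ n ih =>
    refine Submodule.span_le.2 ?_ ih
    rintro _ ⟨τ, rfl⟩
    rw [SetLike.mem_coe]
    change prodδ H a τ n ∈ _
    rw [← mul_one (prodδ H a τ n), ← δ_sum (H := H) (a + n), Finset.mul_sum]
    refine Submodule.sum_mem _ fun g _ => Submodule.subset_span
      ⟨Function.update τ (a + n) g, ?_⟩
    change prodδ H a _ (n + 1) = _
    rw [prodδ, Function.update_self]
    congr 1
    refine prodδ_congr fun x _ hx => ?_
    rw [Function.update_of_ne (by omega)]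

theorem prodρ_one (a : ℤ) (n : ℕ) : prodρ a (fun _ => (1 : H)) n = 1 := by
  induction n with
  | zero => rfl
  | succ n ih => rw [prodρ, ih, ρ_one, mul_one]

theorem one_mem_monoSpan (a : ℤ) (n : ℕ) : (1 : LocAlg H) ∈ monoSpan H a n := by
  refine Submodule.span_le.2 ?_ (one_mem_span_prodδ H a n)
  rintro _ ⟨τ, rfl⟩
  have := mono_mem a n (τ, fun _ => (1 : H))
  rwa [mono, prodρ_one, mul_one] at this

theorem mul_mem_monoSpan {a : ℤ} {n : ℕ} {b s : LocAlg H} (hs : s ∈ monoSpan H a n)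
    (hb : ∀ p, b * mono a n p ∈ monoSpan H a n) : b * s ∈ monoSpan H a n := by
  have : monoSpan H a n ≤ (monoSpan H a n).comap (LinearMap.mulLeft ℂ b) := by
    refine Submodule.span_le.2 ?_
    rintro _ ⟨p, rfl⟩
    exact hb p.1
  exact this hs

theorem exists_mul_mem (b : LocAlg H) :
    ∃ N : ℕ, ∀ n ≥ N, ∀ s ∈ monoSpan H (-n) (2 * n), b * s ∈ monoSpan H (-n) (2 * n) := by
  induction b using LocAlg.induction with
  | hc c =>
    refine ⟨0, fun n _ s hs => ?_⟩
    rw [← Algebra.smul_def]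
    exact Submodule.smul_mem _ _ hs
  | hδ g x =>
    refine ⟨x.natAbs + 1, fun n hn s hs => mul_mem_monoSpan hs fun p => ?_⟩
    rw [mono, ← mul_assoc]
    rcases δ_prodδ (H := H) g (x := x) (a := -n) (n := 2 * n) p.1 (by omega)
      (by push_cast; omega) with h | h
    · rw [h]
      exact mono_mem _ _ p
    · rw [h, zero_mul]
      exact Submodule.zero_mem _
  | hρ k j =>
    refine ⟨j.natAbs + 1, fun n hn s hs => mul_mem_monoSpan hs fun p => ?_⟩
    obtain ⟨h', hh⟩ := ρ_prodρ k (j := j) (a := -n) (n := 2 * n) p.2 (by omega)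
      (by push_cast; omega)
    rw [mono, ← mul_assoc, ρ_prodδ, mul_assoc, hh]
    exact mono_mem _ _ (_, h')
  | hm b c h1 h2 =>
    obtain ⟨N, hN⟩ := h1
    obtain ⟨M, hM⟩ := h2
    refine ⟨max N M, fun n hn s hs => ?_⟩
    rw [mul_assoc]
    exact hN n (by omega) _ (hM n (by omega) _ hs)
  | ha b c h1 h2 =>
    obtain ⟨N, hN⟩ := h1
    obtain ⟨M, hM⟩ := h2
    refine ⟨max N M, fun n hn s hs => ?_⟩
    rw [add_mul]
    exact Submodule.add_mem _ (hN n (by omega) _ hs) (hM n (by omega) _ hs)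

/-- The product of the kinks `h(a), …, h(a+n-1)`. -/
def prodKink (a : ℤ) (h : ℤ → H) : ℕ → Conf H
  | 0 => 1
  | n + 1 => prodKink a h n * kink (h (a + n)) (a + n)

theorem rep_prodρ (a : ℤ) (h : ℤ → H) (n : ℕ) :
    rep (prodρ a h n) = opL (prodKink a h n) := by
  induction n with
  | zero => rw [prodρ, prodKink, opL_one, map_one]
  | succ n ih => rw [prodρ, prodKink, map_mul, ih, rep_ρ, opL_mul]

theorem rep_prodδ (a : ℤ) (τ : ℤ → G) (n : ℕ) :
    rep (prodδ H a τ n) = permOp {c | ∀ x, a ≤ x → x < a + n → c.1 x = τ x} 1 := by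
  induction n with
  | zero =>
    rw [prodδ, map_one, ← permOp_one]
    congr 1
    ext c
    simp only [Set.mem_univ, Set.mem_ofPred_eq, true_iff]
    intro x h1 h2
    push_cast at h2
    omega
  | succ n ih =>
    rw [prodδ, map_mul, ih, rep_δ, opδ, permOp_mul]
    congr 1
    ext c
    constructor
    · rintro ⟨h1, h2⟩ x hx hx'
      by_cases hxn : x = a + n
      · rw [hxn]
        exact h2
      · exact h1 x hx (by push_cast at hx'; omega)
    · intro h
      exact ⟨fun x hx hx' => h x hx (by push_cast; omega),
        h (a + n) (by omega) (by push_cast; omega)⟩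

theorem prodKink_congr {a : ℤ} {n : ℕ} {h h' : ℤ → H}
    (hh : ∀ x, a ≤ x → x < a + n → h x = h' x) : prodKink a h n = prodKink a h' n := by
  induction n with
  | zero => rfl
  | succ n ih =>
    rw [prodKink, prodKink, ih (fun x h1 h2 => hh x h1 (by push_cast; omega)),
      hh (a + n) (by omega) (by push_cast; omega)]

theorem prodKink_inj {a : ℤ} {n : ℕ} {h h' : ℤ → H}
    (hh : ∀ x ≤ a + n, (prodKink a h n).1 x = (prodKink a h' n).1 x) :
    ∀ x, a ≤ x → x < a + n → h x = h' x := by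
  induction n with
  | zero =>
    intro x h1 h2
    push_cast at h2
    omega
  | succ n ih =>
    have key : ∀ x, a ≤ x → x < a + n → h x = h' x := by
      refine ih fun x hx => ?_
      have := hh x (by push_cast; omega)
      simpa [prodKink, kink, not_lt.2 hx] using this
    intro x h1 h2
    by_cases hx : x = a + n
    · have h3 := hh (a + n + 1) (by push_cast; omega)
      simp only [prodKink, kink, Prod.fst_mul, Pi.mul_apply, prodKink_congr key] at h3
      simp only [lt_add_iff_pos_right, zero_lt_one, if_true] at h3
      rw [hx]
      exact Subtype.ext (mul_left_cancel h3)
    · exact key x h1 (by push_cast at h2; omega)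

/-- The representation is faithful: its norm on `F_{H,loc}` is a C*-norm. On each of the
finite-dimensional *-algebras generated by the `δ_g(x)` and `ρ_h(l)` with `x, l` in a finite set,
the C*-norm is unique. -/
theorem rep_injective : Function.Injective (rep (H := H)) := by
  classical
  rw [injective_iff_map_eq_zero]
  intro s hs
  obtain ⟨n, a, hmem⟩ : ∃ (n : ℕ) (a : ℤ), s ∈ monoSpan H a n := by
    obtain ⟨N, hN⟩ := exists_mul_mem s
    exact ⟨2 * N, -N, by simpa using hN N le_rfl 1 (one_mem_monoSpan _ _)⟩
  rw [monoSpan, Finsupp.mem_span_range_iff_exists_finsupp] at hmem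
  obtain ⟨c, rfl⟩ := hmem
  have hval : ∀ p q : Idx H a n, (rep (mono a n p.1) (lp.single 2
      ((prodKink a q.1.2 n)⁻¹ * (q.1.1, 1)) (1 : ℂ))) (q.1.1, 1) = if p = q then 1 else 0 := by
    intro p q
    rw [mono, map_mul, rep_prodδ, rep_prodρ, opL, permOp_mul, permOp_apply]
    by_cases hpq : p = q
    · subst hpq
      simp
    · rw [if_neg hpq]
      split_ifs with hc
      · simp only [mul_one, Equiv.coe_mulLeft]
        rw [lp.single_apply_ne]
        intro he
        apply hpq
        have hk : prodKink a p.1.2 n = prodKink a q.1.2 n := inv_injective (mul_right_cancel he)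
        have h2 := prodKink_inj (n := n) (a := a) (h := p.1.2) (h' := q.1.2)
          (fun x _ => by rw [hk])
        have h1 : ∀ x, a ≤ x → x < a + n → q.1.1 x = p.1.1 x := hc.1
        refine Subtype.ext (Prod.ext (funext fun x => ?_) (funext fun x => ?_))
        · by_cases hx : a ≤ x ∧ x < a + n
          · exact (h1 x hx.1 hx.2).symm
          · rw [(p.2 x hx).1, (q.2 x hx).1]
        · by_cases hx : a ≤ x ∧ x < a + n
          · exact h2 x hx.1 hx.2
          · rw [(p.2 x hx).2, (q.2 x hx).2]
      · rfl
  have hcq : ∀ q, c q = 0 := fun q => by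
    have h0 := congrArg (fun X : Op H => (X (lp.single 2
      ((prodKink a q.1.2 n)⁻¹ * (q.1.1, 1)) (1 : ℂ))) (q.1.1, 1)) hs
    simp only [Finsupp.sum, map_sum, map_smul] at h0
    rw [_root_.sum_apply, lp.coeFn_sum] at h0
    erw [Finset.sum_apply] at h0
    have h1 : ∀ p : Idx H a n, ((c p • rep (mono a n p.1)) (lp.single 2
      ((prodKink a q.1.2 n)⁻¹ * (q.1.1, 1)) (1 : ℂ))) (q.1.1, 1) = if p = q then c p else 0 := by
      intro p
      have := hval p q
      exact (congrArg (fun z => c p * z) this).trans (by simp)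
    rw [Finset.sum_congr rfl fun p _ => h1 p] at h0
    by_cases hq : q ∈ c.support
    · simpa [hq] using h0
    · simpa using hq
  have : c = 0 := Finsupp.ext hcq
  simp [this]

end Faithful

section FieldAlgebra

variable {G : Type*} [Group G] [Fintype G] (H : Subgroup G)

/-- The C*-inductive limit as a C*-subalgebra: the norm closure of the faithfully represented
`F_{H,loc}`. -/
def fieldSub : StarSubalgebra ℂ (Op H) := (rep (H := H)).range.topologicalClosure

/-- The field algebra `F_H`. -/
def FieldAlg : Type _ := fieldSub H

instance : CStarAlgebra (FieldAlg H) :=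
  StarSubalgebra.cstarAlgebra (fieldSub H)
    (h_closed := StarSubalgebra.isClosed_topologicalClosure _)

variable {H}

/-- The embedding of `F_{H,loc}` into `F_H`. -/
def emb : LocAlg H →⋆ₐ[ℂ] FieldAlg H :=
  (rep (H := H)).codRestrict (fieldSub H) fun a =>
    StarSubalgebra.le_topologicalClosure _ ⟨a, rfl⟩

theorem norm_emb (a : LocAlg H) : ‖emb a‖ = ‖rep a‖ := rfl

theorem emb_injective : Function.Injective (emb (H := H)) := fun _ _ h =>
  rep_injective (congrArg Subtype.val h)

theorem emb_denseRange : DenseRange (emb (H := H)) := by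
  intro x
  refine (closure_subtype (X := Op H) (p := fun y => y ∈ fieldSub H)
    (s := Set.range (emb (H := H))) (x := x)).2 ?_
  have hx : (x.1 : Op H) ∈ closure (Set.range (rep (H := H))) := x.2
  refine closure_mono ?_ hx
  rintro _ ⟨a, rfl⟩
  exact ⟨emb a, ⟨a, rfl⟩, rfl⟩

/-- The continuous extension of `F ↦ (h, g)(F)` to `F_H`. -/
def act [H.Normal] (h : H) (g : G) : FieldAlg H →L[ℂ] FieldAlg H :=
  LinearMap.extendOfNorm ((emb (H := H)).toLinearMap ∘ₗ actLoc h g) (emb (H := H)).toLinearMap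

theorem act_emb [H.Normal] (h : H) (g : G) (a : LocAlg H) :
    act h g (emb a) = emb (actLoc h g a) :=
  LinearMap.extendOfNorm_eq (f := (emb (H := H)).toLinearMap ∘ₗ actLoc h g)
    (e := (emb (H := H)).toLinearMap) emb_denseRange (rep_actLoc_bound h g) a

variable (H)

/-- The vector space of `D(H;G)`, the crossed product of `C(H)` and `ℂG`, with its linear basis
`(h, g)`, `h ∈ H`, `g ∈ G`. -/
abbrev Dbl : Type _ := H × G →₀ ℂ

variable {H}

/-- The action `γ` of `D(H;G)` on `F_H`: the linear extension in the first variable of the action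
of the basis elements. -/
def gam [H.Normal] : Dbl H →ₗ[ℂ] FieldAlg H →L[ℂ] FieldAlg H :=
  Finsupp.linearCombination ℂ fun p : H × G => act p.1 p.2

variable (H)

/-- The cointegral `z_H = |G|⁻¹ ∑_g (e, g)` of `D(H;G)`. -/
def zElt : Dbl H := (Nat.card G : ℂ)⁻¹ • ∑ g : G, Finsupp.single (1, g) 1

/-- The map `F ↦ z_H(F)` on `F_H`. -/
def zMap [H.Normal] : FieldAlg H →ₗ[ℂ] FieldAlg H := (gam (zElt H)).toLinearMap

/-- The observable algebra `A_{(H,G)} = {F ∈ F_H | z_H(F) = F}`. -/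
def obsAlg [H.Normal] : Set (FieldAlg H) := {F | zMap H F = F}

/-- The elements `u_{x,y} = √|G| δ_x(k) ρ_y(k + 1/2)`. -/
def qbasis (k : ℤ) (p : G × H) : FieldAlg H :=
  ((Real.sqrt (Nat.card G) : ℝ) : ℂ) • emb (δ H p.1 k * ρ H p.2 k)

end FieldAlgebra

section Index

variable {B : Type*} [CStarAlgebra B]

/-- `Γ` is a conditional expectation of the unital C*-algebra `B` onto its unital C*-subalgebra `A`:
a linear map of `B` onto `A` which is unital, `A`-bimodular and positive (it maps the elements of the
form `b* b` to elements of this form). -/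
structure IsCondExp (A : Set B) (Γ : B →ₗ[ℂ] B) : Prop where
  subalgebra : ∃ S : StarSubalgebra ℂ B, (S : Set B) = A ∧ IsClosed (S : Set B)
  range_eq : Set.range Γ = A
  map_one : Γ 1 = 1
  bimodule : ∀ a₁ ∈ A, ∀ a₂ ∈ A, ∀ b, Γ (a₁ * b * a₂) = a₁ * Γ b * a₂
  positive : ∀ b, ∃ c, Γ (star b * b) = star c * c

/-- The finite family of the pairs `(u i, (u i)*)` is a quasi-basis for `Γ`. -/
def IsQuasiBasis {ι : Type*} [Fintype ι] (Γ : B →ₗ[ℂ] B) (u : ι → B) : Prop :=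
  ∀ a : B, ∑ i, u i * Γ (star (u i) * a) = a ∧ ∑ i, Γ (a * u i) * star (u i) = a

/-- `Γ` is of index-finite type: it has a quasi-basis. -/
def IsIndexFinite (Γ : B →ₗ[ℂ] B) : Prop := ∃ (n : ℕ) (u : Fin n → B), IsQuasiBasis Γ u

open scoped Classical in
/-- The C*-index of `Γ`: the sum of the `u i (u i)*` over a quasi-basis (and `0` if there is none). -/
def cstarIndex (Γ : B →ₗ[ℂ] B) : B :=
  if h : IsIndexFinite Γ then ∑ i, h.choose_spec.choose i * star (h.choose_spec.choose i) else 0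

end Index

end GSpin

end

noncomputable section

namespace GSpin

/-! The field algebra sits inside the bounded operators on `ℓ²` of the configurations, and there the
action becomes spatial: `(h, g)` conjugates by the unitary `opV g` and then takes the component of
degree `h` for the `H`-grading cut out by the projections `opQ k` on the spin at `+∞` (`toOp_act`).
So `z_H` is the restriction of `opZ`, the average over `G` of the degree-one components of the
conjugates.

Both operations project onto commutants. The values of `opZ` commute with all `opV g` and `opQ k`,
and operators of that commutant pull out of `opZ` on both sides. Hence the observable algebra is the
trace on `F_H` of the commutant `invSub`, and closedness, fixed points and bimodularity follow.
Positivity comes from the coproduct rule: `act_star` turns `z_H(b* b)` into a positive multiple of a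
sum of terms `c* c`.

The quasi-basis works because each factor of `δ_x(k) ρ_y(k + 1/2)` detects one part of the action.
In `u z_H(u* a)` the average over `g` collapses to `g = 1`: any other `g` moves `δ_x(k)` to
`δ_{gx}(k)`, which is orthogonal to it, and the kink right of `k` does not disturb this. In the
surviving term `ρ_{y⁻¹}` shifts the degree, leaving `δ_x(k)` times the degree-`y` component of `a`.
Summing over `x` and `y` restores `a` (`sum_opδ_opL_opZ`); the second identity is the adjoint of the
first. Since the kinks are unitary, `u u* = |G| δ_x(k)`, and the sum is `|G||H|`. Independence of
the quasi-basis is formal: one basis is expanded in the other. -/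

/-- Nonnegative multiples of sums of elements `b* b` of a C*-algebra are of the form `c* c`. -/
theorem exists_eq_star_mul_self_of_sum {B ι : Type*} [CStarAlgebra B] [Fintype ι] {r : ℝ}
    (hr : 0 ≤ r) (f : ι → B) : ∃ c, r • ∑ i, star (f i) * f i = star c * c := by
  -- In the spectral order the elements `c* c` are exactly the nonnegative ones, so they form a
  -- cone.
  let _ : PartialOrder B := CStarAlgebra.spectralOrder _
  have _ : StarOrderedRing B := CStarAlgebra.spectralOrderedRing _
  refine CStarAlgebra.nonneg_iff_eq_star_mul_self.1 ?_
  exact smul_nonneg hr (Finset.sum_nonneg fun i _ => star_mul_self_nonneg _)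

/-! ### The `H`-grading and the unitaries of `G` on operators -/

section Operators

variable {G : Type*} [Group G] [Fintype G] {H : Subgroup G} [H.Normal]

theorem opQ_star (k : H) : star (opQ k : Op H) = opQ k := by
  rw [opQ, permOp_star]
  rfl

/-- The adjoint exchanges the two projections around `X`, so the degree is inverted after reindexing
`k` by `h * k`. -/
theorem opE_star [Fintype H] (h : H) (X : Op H) : star (opE h X) = opE h⁻¹ (star X) := by
  rw [opE, opE, star_sum,
    ← Equiv.sum_comp (Equiv.mulLeft h) fun k => opQ (h⁻¹ * k) * star X * opQ k]
  refine Finset.sum_congr rfl fun k _ => ?_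
  simp [opQ_star, mul_assoc]

/-- For fixed `k` the projections `opQ (h * k)` run over a resolution of the identity; then so do
the `opQ k` on the right. -/
theorem opE_sum [Fintype H] (X : Op H) : ∑ h : H, opE h X = X := by
  simp only [opE]
  rw [Finset.sum_comm]
  have key : ∀ k : H, ∑ h : H, (opQ (h * k) : Op H) = 1 := fun k => by
    rw [← opQ_sum (H := H)]
    exact Equiv.sum_comp (Equiv.mulRight k) (fun h => (opQ h : Op H))
  simp only [← Finset.sum_mul, key, one_mul, ← Finset.mul_sum, opQ_sum, mul_one]

theorem continuous_opE [Fintype H] (h : H) : Continuous (opE h : Op H → Op H) := by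
  unfold opE
  fun_prop

/-- Homogeneous elements pull out of the components. -/
theorem opE_mul_of_comm [Fintype H] (h d : H) (X Y : Op H)
    (hX : ∀ k, X * opQ k = opQ (d * k) * X) : opE h (X * Y) = X * opE (d⁻¹ * h) Y := by
  classical
  -- `X` is its own degree-`d` component and has no other, so one term of the product rule survives.
  rw [opE_mul, Finset.sum_eq_single d]
  · rw [opE_of_comm d d X hX, if_pos rfl]
  · intro t _ ht
    rw [opE_of_comm t d X hX, if_neg ht, zero_mul]
  · simp

/-- Degree one means block-diagonal: multiplying by `opQ k` on either side leaves the block `opQ k *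
X * opQ k`. -/
theorem opQ_mul_opE_one [Fintype H] (k : H) (X : Op H) :
    opQ k * opE 1 X = opE 1 X * opQ k := by
  classical
  have h1 : opQ k * opE 1 X = opQ k * X * opQ k := by
    rw [opE, Finset.mul_sum, Finset.sum_eq_single k]
    · simp [← mul_assoc, opQ_mul]
    · intro l _ hl
      simp [← mul_assoc, opQ_mul, hl.symm]
    · simp
  have h2 : opE 1 X * opQ k = opQ k * X * opQ k := by
    rw [opE, Finset.sum_mul, Finset.sum_eq_single k]
    · simp [mul_assoc, opQ_mul]
    · intro l _ hl
      simp [mul_assoc, opQ_mul, hl]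
    · simp
  rw [h1, h2]

theorem opδ_mul_opδ_of_ne {g₁ g₂ : G} (x : ℤ) (h : g₁ ≠ g₂) :
    (opδ g₁ x * opδ g₂ x : Op H) = 0 := by
  rw [← rep_δ, ← rep_δ, ← map_mul, δ_orth x h, map_zero]

theorem opδ_idem (g : G) (x : ℤ) : (opδ g x * opδ g x : Op H) = opδ g x := by
  rw [← rep_δ, ← map_mul, δ_idem]

theorem opδ_sum (x : ℤ) : ∑ g : G, (opδ g x : Op H) = 1 := by
  simp only [← rep_δ, ← map_sum, δ_sum, map_one]

/-- The kink at `k + 1/2` changes only spins strictly to the right of `k`. -/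
theorem opL_kink_δ (h : H) (g : G) (k : ℤ) :
    opL (kink h k) * opδ g k = opδ g k * opL (kink h k) := by
  rw [← rep_δ, ← rep_ρ, ← map_mul, ← map_mul, ρ_δ_gt h g le_rfl]

theorem opL_kink_mul (h₁ h₂ : H) (k : ℤ) :
    opL (kink h₁ k) * opL (kink h₂ k) = opL (kink (h₁ * h₂) k) := by
  rw [opL_mul, kink_mul]

theorem opV_star (g : G) : star (opV g : Op H) = opV g⁻¹ := by
  rw [opV, permOp_star, opV]
  congr 1
  -- Writing `1` as `confPerm (g⁻¹ * g)` lets the inverse permutation cancel `confPerm g⁻¹`.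
  rw [inv_inv, ← mul_one (confPerm g⁻¹).symm, ← confPerm_one, ← inv_mul_cancel g, confPerm_mul]
  ext1 c
  simp

theorem opV_inv' (g : G) : (opV g⁻¹ * opV g : Op H) = 1 := by
  simpa using opV_inv (H := H) g⁻¹

theorem opV_Q (g : G) (k : H) : (opV g * opQ k : Op H) = opQ (cj g k) * opV g := by
  rw [opV, opQ, opQ, permOp_mul, permOp_mul]
  congr 1
  ext c
  simp only [Set.univ_inter, Set.mem_preimage, Set.mem_ofPred_eq, Set.preimage_univ,
    Set.inter_univ]
  change MulAut.conjNormal g⁻¹ c.2 = k ↔ _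
  rw [map_inv, MulAut.inv_apply, MulEquiv.symm_apply_eq]

theorem conj_opV_mul (g : G) (X Y : Op H) :
    opV g * (X * Y) * opV g⁻¹ = (opV g * X * opV g⁻¹) * (opV g * Y * opV g⁻¹) := by
  calc _ = opV g * X * 1 * Y * opV g⁻¹ := by simp only [mul_assoc, one_mul]
    _ = _ := by
      rw [← opV_inv' g]
      simp only [mul_assoc]

/-- Since `g` conjugates the spin at `+∞`, conjugation by `opV g` permutes the `opQ k` by an
automorphism of `H`, and degrees are transported by the same automorphism. -/
theorem conj_opV_opE [Fintype H] (g : G) (h : H) (X : Op H) :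
    opV g * opE h X * opV g⁻¹ = opE (cj g h) (opV g * X * opV g⁻¹) := by
  have conjQ : ∀ k : H, opV g * opQ k * opV g⁻¹ = (opQ (cj g k) : Op H) := fun k => by
    rw [opV_Q, mul_assoc, opV_inv, mul_one]
  rw [opE, opE, Finset.mul_sum, Finset.sum_mul,
    ← Equiv.sum_comp (MulAut.conjNormal (H := H) g).toEquiv
      fun k => opQ (cj g h * k) * (opV g * X * opV g⁻¹) * opQ k]
  refine Finset.sum_congr rfl fun k _ => ?_
  rw [conj_opV_mul, conj_opV_mul, conjQ, conjQ, cj_mul]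
  rfl

/-! ### The averaged expectation and its commutant -/

/-- The averaged zero-degree component of an operator. -/
def opZ [Fintype H] (X : Op H) : Op H :=
  (Nat.card G : ℂ)⁻¹ • ∑ g : G, opE 1 (opV g * X * opV g⁻¹)

theorem opQ_opZ [Fintype H] (k : H) (X : Op H) : opQ k * opZ X = opZ X * opQ k := by
  simp only [opZ, mul_smul_comm, smul_mul_assoc, Finset.mul_sum, Finset.sum_mul, opQ_mul_opE_one]

/-- Conjugation by `opV s` translates the average by `s` and keeps the degree, because `1` is fixed
by conjugation. -/
theorem opV_opZ [Fintype H] (s : G) (X : Op H) : opV s * opZ X = opZ X * opV s := by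
  have h : opV s * opZ X * opV s⁻¹ = opZ X := by
    simp only [opZ, mul_smul_comm, smul_mul_assoc, Finset.mul_sum, Finset.sum_mul]
    congr 1
    rw [← Equiv.sum_comp (Equiv.mulLeft s) fun g => opE 1 (opV g * X * opV g⁻¹)]
    refine Finset.sum_congr rfl fun g _ => ?_
    rw [conj_opV_opE, cj_one, Equiv.coe_mulLeft, mul_inv_rev, ← opV_mul, ← opV_mul]
    simp only [mul_assoc]
  rw [← mul_one (opV s * opZ X), ← opV_inv' s, ← mul_assoc, h]

/-- The operators commuting with the projections `opQ` and the unitaries `opV`. -/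
def invSub (H : Subgroup G) [H.Normal] : StarSubalgebra ℂ (Op H) :=
  StarSubalgebra.centralizer ℂ (Set.range opV ∪ Set.range opQ)

/-- The family of the `opV g` and `opQ k` is closed under adjoints, so the adjoint half of the
centralizer condition is automatic. -/
theorem mem_invSub {X : Op H} :
    X ∈ invSub H ↔ (∀ g, opV g * X = X * opV g) ∧ ∀ k, opQ k * X = X * opQ k := by
  rw [invSub, StarSubalgebra.mem_centralizer_iff]
  constructor
  · intro h
    exact ⟨fun g => (h _ (Or.inl ⟨g, rfl⟩)).1, fun k => (h _ (Or.inr ⟨k, rfl⟩)).1⟩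
  · rintro ⟨h1, h2⟩ _ (⟨g, rfl⟩ | ⟨k, rfl⟩)
    · rw [opV_star]
      exact ⟨h1 g, h1 g⁻¹⟩
    · rw [opQ_star]
      exact ⟨h2 k, h2 k⟩

theorem isClosed_invSub : IsClosed (invSub H : Set (Op H)) := by
  have : (invSub H : Set (Op H))
      = (⋂ g, {X | opV g * X = X * opV g}) ∩ ⋂ k, {X | opQ k * X = X * opQ k} := by
    ext X
    simp [mem_invSub]
  rw [this]
  refine IsClosed.inter (isClosed_iInter fun g => ?_) (isClosed_iInter fun k => ?_)
  · exact isClosed_eq (by fun_prop) (by fun_prop)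
  · exact isClosed_eq (by fun_prop) (by fun_prop)

variable [Fintype H]

theorem opZ_mem (X : Op H) : opZ X ∈ invSub H :=
  mem_invSub.2 ⟨fun g => opV_opZ g X, fun k => opQ_opZ k X⟩

/-- In every summand `A` and `B` pass first the unitaries, then the projections, and end up outside.
-/
theorem opZ_mul_mul {A B : Op H} (hA : A ∈ invSub H) (hB : B ∈ invSub H) (X : Op H) :
    opZ (A * X * B) = A * opZ X * B := by
  rw [mem_invSub] at hA hB
  simp only [opZ, mul_smul_comm, smul_mul_assoc, Finset.mul_sum, Finset.sum_mul]
  congr 1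
  refine Finset.sum_congr rfl fun g _ => ?_
  simp only [opE, Finset.mul_sum, Finset.sum_mul, one_mul]
  refine Finset.sum_congr rfl fun k _ => ?_
  calc opQ k * (opV g * (A * X * B) * opV g⁻¹) * opQ k
      = opQ k * (opV g * A) * X * (B * opV g⁻¹) * opQ k := by simp only [mul_assoc]
    _ = (opQ k * A) * opV g * X * opV g⁻¹ * (B * opQ k) := by
      rw [hA.1, ← hB.1]
      simp only [mul_assoc]
    _ = A * (opQ k * (opV g * X * opV g⁻¹) * opQ k) * B := by
      rw [hA.2, ← hB.2]
      simp only [mul_assoc]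

theorem opZ_one : opZ (1 : Op H) = 1 := by
  have h : opE 1 (1 : Op H) = 1 := by
    classical
    rw [opE_of_comm 1 1 1 (fun k => by simp), if_pos rfl]
  have hc : (Nat.card G : ℂ) ≠ 0 := Nat.cast_ne_zero.2 Nat.card_pos.ne'
  simp only [opZ, mul_one, opV_inv, h, Finset.sum_const, Finset.card_univ, ← Nat.card_eq_fintype_card]
  rw [← Nat.cast_smul_eq_nsmul ℂ, smul_smul, inv_mul_cancel₀ hc, one_smul]

theorem opZ_eq_iff {X : Op H} : opZ X = X ↔ X ∈ invSub H := by
  refine ⟨fun h => h ▸ opZ_mem X, fun h => ?_⟩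
  -- Bimodularity at the unit: `opZ (X * 1 * 1) = X * opZ 1 = X`.
  have := opZ_mul_mul h (one_mem (invSub H)) 1
  simpa [opZ_one] using this

theorem opZ_star (X : Op H) : opZ (star X) = star (opZ X) := by
  rw [opZ, opZ, star_smul, star_sum]
  congr 1
  · simp
  · refine Finset.sum_congr rfl fun g _ => ?_
    rw [opE_star]
    simp [opV_star, mul_assoc]

/-! ### Reconstruction and index sum for operators -/

/-- The reconstruction identity for the elements `δ_x(k) ρ_y(k + 1/2)`. -/
theorem sum_opδ_opL_opZ (k : ℤ) (X : Op H) :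
    ∑ p : G × H, (Nat.card G : ℂ) • (opδ p.1 k * opL (kink p.2 k)
      * opZ (star (opδ p.1 k * opL (kink p.2 k)) * X)) = X := by
  classical
  have hc : (Nat.card G : ℂ) ≠ 0 := Nat.cast_ne_zero.2 Nat.card_pos.ne'
  -- The factor `|G|` cancels the normalisation of the average, of which only `g = 1` contributes.
  have key : ∀ (x : G) (y : H), (Nat.card G : ℂ) • (opδ x k * opL (kink y k)
      * opZ (star (opδ x k * opL (kink y k)) * X)) = opδ x k * opE y X := by
    intro x y
    rw [opZ, mul_smul_comm, smul_smul, mul_inv_cancel₀ hc, one_smul, Finset.mul_sum,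
      Finset.sum_eq_single 1]
    · have h1 : (opV 1 : Op H) = 1 := by rw [opV, inv_one, confPerm_one, permOp_one]
      -- Pulling out `ρ_{y⁻¹}` turns the degree `1` into `y`; pulling out `δ_x(k)`, of degree one,
      -- leaves it at `y`.
      rw [inv_one, h1, one_mul, mul_one, star_mul, opL_star, opδ_star, kink_inv, mul_assoc _ _ X,
        opE_mul_of_comm 1 y⁻¹ _ _ (opL_Q _ _), inv_inv, mul_one,
        opE_mul_of_comm y 1 _ _ (fun k => by rw [one_mul, opδ_Q]), inv_one, one_mul]
      calc _ = opδ x k * (opL (kink y k) * opL (kink y⁻¹ k)) * opδ x k * opE y X := by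
            simp only [mul_assoc]
        _ = _ := by rw [opL_kink_mul, mul_inv_cancel, kink_one, opL_one, mul_one, opδ_idem]
    · intro g _ hg
      -- `G` acts freely on itself by left translation: this is what kills the terms with `g ≠ 1`.
      have hne : x ≠ g * x := fun h => hg (by simpa using h.symm)
      have e : opV g * (star (opδ x k * opL (kink y k)) * X) * opV g⁻¹
          = opL (kink (cj g y⁻¹) k) * (opδ (g * x) k * (opV g * X * opV g⁻¹)) := by
        rw [star_mul, opL_star, opδ_star, kink_inv]
        calc _ = opV g * opL (kink y⁻¹ k) * opδ x k * X * opV g⁻¹ := by simp only [mul_assoc]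
          _ = opL (kink (cj g y⁻¹) k) * (opV g * opδ x k) * X * opV g⁻¹ := by
            rw [opV_L]
            simp only [mul_assoc]
          _ = _ := by
            rw [opV_δ]
            simp only [mul_assoc]
      rw [e, opE_mul_of_comm _ _ _ _ (opL_Q _ _),
        opE_mul_of_comm _ 1 _ _ (fun k => by rw [one_mul, opδ_Q])]
      -- The remaining component is irrelevant, since the factors to its left already multiply to
      -- zero.
      generalize opE _ (opV g * X * opV g⁻¹) = Y
      calc opδ x k * opL (kink y k) * (opL (kink (cj g y⁻¹) k) * (opδ (g * x) k * Y))
          = opδ x k * (opL (kink y k) * opL (kink (cj g y⁻¹) k) * opδ (g * x) k) * Y := by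
            simp only [mul_assoc]
        _ = opδ x k * opδ (g * x) k * opL (kink (y * cj g y⁻¹) k) * Y := by
            rw [opL_kink_mul, opL_kink_δ]
            simp only [mul_assoc]
        _ = 0 := by rw [opδ_mul_opδ_of_ne k hne, zero_mul, zero_mul]
    · simp
  rw [Finset.sum_congr rfl fun p _ => key p.1 p.2, Fintype.sum_prod_type]
  simp only [← Finset.mul_sum, opE_sum, ← Finset.sum_mul, opδ_sum, one_mul]

theorem sum_opδ_opL_mul_star (k : ℤ) :
    ∑ p : G × H, (Nat.card G : ℂ) • ((opδ p.1 k * opL (kink p.2 k))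
      * star (opδ p.1 k * opL (kink p.2 k)))
      = ((Nat.card G : ℂ) * (Nat.card H : ℂ)) • (1 : Op H) := by
  -- The kink is unitary and drops out. The value does not depend on `y`, whence the factor `|H|`.
  have key : ∀ p : G × H, (opδ p.1 k * opL (kink p.2 k)) * star (opδ p.1 k * opL (kink p.2 k))
      = opδ p.1 k := fun p => by
    rw [star_mul, opL_star, opδ_star, mul_assoc, ← mul_assoc (opL _), opL_mul, mul_inv_cancel,
      opL_one, one_mul, opδ_idem]
  simp only [key]
  rw [← Finset.smul_sum, Fintype.sum_prod_type_right]
  simp only [opδ_sum, Finset.sum_const, Finset.card_univ, ← Nat.card_eq_fintype_card]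
  rw [← Nat.cast_smul_eq_nsmul ℂ, smul_smul]

end Operators

/-! ### Transfer to the field algebra -/

section FieldAlgebra

variable {G : Type*} [Group G] [Fintype G] {H : Subgroup G}

/-- The inclusion of the field algebra into the bounded operators. -/
def toOp : FieldAlg H →⋆ₐ[ℂ] Op H := (fieldSub H).subtype

theorem toOp_injective : Function.Injective (toOp (H := H)) := Subtype.val_injective

theorem continuous_toOp : Continuous (toOp (H := H)) := continuous_subtype_val

theorem toOp_emb (a : LocAlg H) : toOp (emb a) = rep a := rfl

theorem toOp_qbasis (k : ℤ) (p : G × H) :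
    toOp (qbasis H k p)
      = ((Real.sqrt (Nat.card G) : ℝ) : ℂ) • (opδ p.1 k * opL (kink p.2 k)) := by
  rw [qbasis, map_smul, toOp_emb, map_mul, rep_δ, rep_ρ]

variable [H.Normal] [Fintype H]

/-- Both sides are continuous in `F` and agree on the dense local algebra by `rep_actLoc`. -/
theorem toOp_act (h : H) (g : G) (F : FieldAlg H) :
    toOp (act h g F) = opE h (opV g * toOp F * opV g⁻¹) := by
  have : (fun F : FieldAlg H => toOp (act h g F))
      = fun F => opE h (opV g * toOp F * opV g⁻¹) := by
    refine emb_denseRange.equalizer (continuous_toOp.comp (act h g).continuous) ?_ ?_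
    · have h1 : Continuous fun X : Op H => opV g * X * opV g⁻¹ := by fun_prop
      exact (continuous_opE h).comp (h1.comp continuous_toOp)
    · funext a
      simp only [Function.comp_apply]
      rw [act_emb, toOp_emb, toOp_emb, rep_actLoc]
  exact congrFun this F

theorem act_star (h : H) (g : G) (F : FieldAlg H) : act h g (star F) = star (act h⁻¹ g F) := by
  apply toOp_injective
  rw [map_star toOp, toOp_act, toOp_act, opE_star, map_star]
  simp [opV_star, mul_assoc]

theorem act_mul (h : H) (g : G) (E F : FieldAlg H) :
    act h g (E * F) = ∑ t : H, act t g E * act (t⁻¹ * h) g F := by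
  apply toOp_injective
  simp only [map_sum, map_mul, toOp_act, conj_opV_mul, opE_mul]

theorem zMap_apply (F : FieldAlg H) :
    zMap H F = (Nat.card G : ℂ)⁻¹ • ∑ g : G, act 1 g F := by
  simp [zMap, gam, zElt]

theorem toOp_zMap (F : FieldAlg H) : toOp (zMap H F) = opZ (toOp F) := by
  simp only [zMap_apply, opZ, map_smul, map_sum, toOp_act]

theorem zMap_star (F : FieldAlg H) : zMap H (star F) = star (zMap H F) := by
  apply toOp_injective
  rw [map_star toOp, toOp_zMap, toOp_zMap, map_star, opZ_star]

theorem mem_obsAlg {F : FieldAlg H} : F ∈ obsAlg H ↔ toOp F ∈ invSub H := by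
  rw [obsAlg, Set.mem_ofPred_eq, ← toOp_injective.eq_iff, toOp_zMap, opZ_eq_iff]

/-- In degree `1` the product rule pairs `t` with `t⁻¹`, and the component of `b*` at `t` is the
adjoint of that of `b` at `t⁻¹`. Each term is therefore `c* c`. -/
theorem zMap_positive (b : FieldAlg H) : ∃ c, zMap H (star b * b) = star c * c := by
  have h : zMap H (star b * b)
      = (Nat.card G : ℝ)⁻¹ • ∑ p : G × H, star (act p.2⁻¹ p.1 b) * act p.2⁻¹ p.1 b := by
    rw [zMap_apply, ← Complex.coe_smul, Fintype.sum_prod_type]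
    simp only [act_mul, act_star, mul_one, Complex.ofReal_inv, Complex.ofReal_natCast]
  rw [h]
  exact exists_eq_star_mul_self_of_sum (by positivity) _

theorem isCondExp_zMap : IsCondExp (obsAlg H) (zMap H) where
  subalgebra := by
    refine ⟨(invSub H).comap toOp, ?_, ?_⟩
    · ext F
      exact mem_obsAlg.symm
    · exact isClosed_invSub.preimage continuous_toOp
  range_eq := by
    refine Set.Subset.antisymm ?_ fun F hF => ⟨F, hF⟩
    rintro _ ⟨F, rfl⟩
    rw [mem_obsAlg, toOp_zMap]
    exact opZ_mem _
  map_one := by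
    apply toOp_injective
    rw [toOp_zMap, map_one, opZ_one]
  bimodule a₁ h₁ a₂ h₂ b := by
    apply toOp_injective
    rw [toOp_zMap, map_mul, map_mul, map_mul, map_mul, toOp_zMap,
      opZ_mul_mul (mem_obsAlg.1 h₁) (mem_obsAlg.1 h₂)]
  positive := zMap_positive

theorem sqrt_card_mul_self :
    ((Real.sqrt (Nat.card G) : ℝ) : ℂ) * ((Real.sqrt (Nat.card G) : ℝ) : ℂ) = Nat.card G := by
  rw [← Complex.ofReal_mul, Real.mul_self_sqrt (by positivity), Complex.ofReal_natCast]

theorem sum_qbasis_zMap (k : ℤ) (a : FieldAlg H) :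
    ∑ p : G × H, qbasis H k p * zMap H (star (qbasis H k p) * a) = a := by
  apply toOp_injective
  -- The two factors `√|G|`, one from `u` and one from `u*`, combine to the weight `|G|` of the
  -- operator identity.
  refine Eq.trans ?_ (sum_opδ_opL_opZ k (toOp a))
  rw [map_sum]
  refine Finset.sum_congr rfl fun p _ => ?_
  have hz : ∀ (c : ℂ) (X : Op H), opZ (c • X) = c • opZ X := fun c X => by
    simp only [opZ, opE, mul_smul_comm, smul_mul_assoc, ← Finset.smul_sum]
    rw [smul_comm]
  rw [map_mul, toOp_zMap, map_mul, map_star, toOp_qbasis, star_smul, Complex.star_def,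
    Complex.conj_ofReal, smul_mul_assoc, smul_mul_assoc, hz, mul_smul_comm, smul_smul,
    sqrt_card_mul_self]

theorem isQuasiBasis_qbasis (k : ℤ) : IsQuasiBasis (zMap H) (qbasis H k) := by
  refine fun a => ⟨sum_qbasis_zMap k a, ?_⟩
  -- The second identity is the adjoint of the first at `a*`, because `z_H` commutes with the
  -- adjoint.
  rw [← star_inj, ← sum_qbasis_zMap k (star a), star_sum]
  refine Finset.sum_congr rfl fun p _ => ?_
  rw [star_mul, star_star, ← zMap_star, star_mul]

theorem sum_qbasis_mul_star (k : ℤ) :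
    ∑ p : G × H, qbasis H k p * star (qbasis H k p)
      = ((Nat.card G : ℂ) * (Nat.card H : ℂ)) • (1 : FieldAlg H) := by
  apply toOp_injective
  rw [map_smul, map_one, map_sum, ← sum_opδ_opL_mul_star k]
  refine Finset.sum_congr rfl fun p _ => ?_
  rw [map_mul, map_star, toOp_qbasis, star_smul, Complex.star_def, Complex.conj_ofReal,
    smul_mul_smul_comm, sqrt_card_mul_self]

end FieldAlgebra

/-! ### Independence of the quasi-basis and the value of the index -/

section Index

variable {B : Type*} [CStarAlgebra B] {Γ : B →ₗ[ℂ] B}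

/-- The index does not depend on the quasi-basis. -/
theorem IsQuasiBasis.sum_mul_star_eq {ι κ : Type*} [Fintype ι] [Fintype κ] {u : ι → B} {v : κ → B}
    (hu : IsQuasiBasis Γ u) (hv : IsQuasiBasis Γ v) :
    ∑ i, u i * star (u i) = ∑ j, v j * star (v j) := by
  -- Each `u i` is expanded by the left identity for `v`; after exchanging sums, the right identity
  -- for `u` at `star (v j)` contracts the inner one.
  calc ∑ i, u i * star (u i) = ∑ i, (∑ j, v j * Γ (star (v j) * u i)) * star (u i) :=
        Finset.sum_congr rfl fun i _ => by rw [(hv (u i)).1]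
    _ = ∑ j, v j * ∑ i, Γ (star (v j) * u i) * star (u i) := by
        simp only [Finset.sum_mul, Finset.mul_sum, mul_assoc]
        exact Finset.sum_comm
    _ = ∑ j, v j * star (v j) := Finset.sum_congr rfl fun j _ => by rw [(hu (star (v j))).2]

theorem IsQuasiBasis.isIndexFinite {ι : Type*} [Fintype ι] {u : ι → B} (hu : IsQuasiBasis Γ u) :
    IsIndexFinite Γ := by
  refine ⟨Fintype.card ι, u ∘ (Fintype.equivFin ι).symm, fun a => ⟨?_, ?_⟩⟩
  · exact (Equiv.sum_comp (Fintype.equivFin ι).symm fun i => u i * Γ (star (u i) * a)).trans (hu a).1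
  · exact (Equiv.sum_comp (Fintype.equivFin ι).symm fun i => Γ (a * u i) * star (u i)).trans (hu a).2

theorem IsQuasiBasis.cstarIndex_eq {ι : Type*} [Fintype ι] {u : ι → B} (hu : IsQuasiBasis Γ u) :
    cstarIndex Γ = ∑ i, u i * star (u i) := by
  rw [cstarIndex, dif_pos hu.isIndexFinite]
  exact IsQuasiBasis.sum_mul_star_eq hu.isIndexFinite.choose_spec.choose_spec hu

end Index

theorem cstarIndex_zMap {G : Type*} [Group G] [Fintype G] (H : Subgroup G) [H.Normal] :
    cstarIndex (zMap H) = ((Nat.card G : ℂ) * (Nat.card H : ℂ)) • (1 : FieldAlg H) := by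
  have : Fintype H := Fintype.ofFinite H
  -- The site `0` is arbitrary.
  rw [(isQuasiBasis_qbasis (H := H) 0).cstarIndex_eq, sum_qbasis_mul_star]

end GSpin

end

theorem theorem3p2 {G : Type*} [Group G] [Fintype G] (H : Subgroup G) [H.Normal] [Fintype H] :
    -- `z_H` is a conditional expectation of `F_H` onto `A_{(H,G)}`, of index-finite type
    GSpin.IsCondExp (GSpin.obsAlg H) (GSpin.zMap H) ∧
    GSpin.IsIndexFinite (GSpin.zMap H) ∧
    -- for each site `k`, the `u_{x,y}` form a quasi-basis, with `∑ u_{x,y} u_{x,y}^* = |G||H| I`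
    (∀ k : ℤ, GSpin.IsQuasiBasis (GSpin.zMap H) (GSpin.qbasis H k) ∧
      ∑ p : G × H, GSpin.qbasis H k p * star (GSpin.qbasis H k p)
        = ((Nat.card G : ℂ) * (Nat.card H : ℂ)) • (1 : GSpin.FieldAlg H)) ∧
    -- every quasi-basis gives the value `|G||H| I`, which is the C*-index
    (∀ (n : ℕ) (u : Fin n → GSpin.FieldAlg H), GSpin.IsQuasiBasis (GSpin.zMap H) u →
      ∑ i, u i * star (u i)
        = ((Nat.card G : ℂ) * (Nat.card H : ℂ)) • (1 : GSpin.FieldAlg H)) ∧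
    GSpin.cstarIndex (GSpin.zMap H)
      = ((Nat.card G : ℂ) * (Nat.card H : ℂ)) • (1 : GSpin.FieldAlg H) ∧
    -- the case `H = G`
    GSpin.cstarIndex (GSpin.zMap (⊤ : Subgroup G))
      = ((Nat.card G : ℂ) ^ 2) • (1 : GSpin.FieldAlg (⊤ : Subgroup G)) := by
  refine ⟨GSpin.isCondExp_zMap, (GSpin.isQuasiBasis_qbasis 0).isIndexFinite,
    fun k => ⟨GSpin.isQuasiBasis_qbasis k, GSpin.sum_qbasis_mul_star k⟩, fun n u hu => ?_,
    GSpin.cstarIndex_zMap H, ?_⟩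
  · rw [hu.sum_mul_star_eq (GSpin.isQuasiBasis_qbasis 0), GSpin.sum_qbasis_mul_star]
  · rw [GSpin.cstarIndex_zMap, Subgroup.card_top, sq]
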